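/- Let $d\ge 0$ be an integer and $M\in\mathbb R$. Write $\langle x\rangle=(1+|x|^2)^{1/2}$. For a measurable kernel $K:\mathbb R^d\times\mathbb R^d\to\mathbb C$ and $\alpha\ge 0$ put $$\|K\|_\alpha=\max\Big\{\sup_x\int|K(x,y)|\langle x-y\rangle^\alpha\,dy,\ \sup_y\int|K(x,y)|\langle x-y\rangle^\alpha\,dx\Big\},$$ and, if $\|K\|_\alpha<\infty$, let $T_K$ be the bounded integral operator with kernel $K$ on $L^2(\mathbb R^d)$. Let $A:\mathbb R^d\to\mathbb R^d$ be a $C^1$ vector potential whose magnetic field $B=dA$, $B_{jk}=\partial_jA_k-\partial_kA_j$, satisfies $|B_{jk}|\le M$ everywhere. For a two-form $B$ with continuous components let $$\Phi^B(x,y,z)=\sum_{j,k}(y_j-x_j)(z_k-y_k)\int_0^1dt\int_0^tds\,B_{jk}(x+t(y-x)+s(z-y))$$ be its flux through the triangle with vertices $x,y,z$. Put $\phi^A(x,y)=-\Phi^{B}(0,x,y)$ with $B=dA$, and $\phi^{A_\varepsilon}(x,y)=-\varepsilon\,\Phi^{B_\varepsilon}(0,x,y)$ with $B_\varepsilon(x)=(dA)(\varepsilon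 x)$ (the phase of the slowly varying potential $A_\varepsilon(x)=A(\varepsilon x)$). For $c\in\mathbb C$ such that $c\,\mathrm{Id}+T_K$ is self-adjoint, let $$\mathcal E(\varepsilon)=\sup\sigma\big(c\,\mathrm{Id}+T_{e^{i\varepsilon\phi^A}K}\big),\qquad \mathcal E_\varepsilon=\sup\sigma\big(c\,\mathrm{Id}+T_{e^{i\phi^{A_\varepsilon}}K}\big).$$ Below, the constants depend only on $d$ and $M$ (and on $\alpha$ where indicated), not on $A$, $c$, $K$ or $\varepsilon$. (i) There are constants $C_\alpha>0$, $1\le\alpha<2$, with $\lim_{\alpha\nearrow2}C_\alpha=\infty$, such that if $1\le\alpha<2$ and $\|K\|_\alpha<\infty$, then $|\mathcal E(\varepsilon)-\mathcal E(0)|\le C_\alpha\|K\|_\alpha|\varepsilon|^{\alpha/2}$ for all $|\varepsilon|\le 1/2$. (ii) There is a constant $C>0$ such that if $\alpha\ge2$ and $\|K\|_\alpha<\infty$, then $|\mathcal E(\varepsilon)-\mathcal E(0)|\le C\|K\|_2\,|\varepsilon|\ln(1/|\varepsilon|)$ for all $|\varepsilon|\le1/2$ (the right-hand side being $0$ at $\varepsilon=0$).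 (iii) There is a constant $C>0$ such that if $\alpha\ge2$ and $\|K\|_\alpha<\infty$, then for all $|\varepsilon|\le1/2$: if $B=dA$ is constant, then $|\mathcal E(\varepsilon)-\mathcal E(0)|\le C\|K\|_2|\varepsilon|$; and if the components of $dA$ are differentiable with all first order partial derivatives bounded by $M$ in absolute value, then $|\mathcal E_\varepsilon-\mathcal E_0|\le C\|K\|_2|\varepsilon|$. -/

import Mathlib

open MeasureTheory Set Filter Topology
open scoped ENNReal

noncomputable section

namespace MagneticEdge

/-- Euclidean space `ℝ^d`. -/
abbrev Space (d : ℕ) : Type := EuclideanSpace ℝ (Fin d)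

/-- The complex Hilbert space `L²(ℝ^d)`. -/
abbrev L2 (d : ℕ) : Type := Lp ℂ 2 (volume : Measure (Space d))

/-- `⟨x⟩ = (1 + |x|²)^{1/2}`. -/
def bracket {d : ℕ} (x : Space d) : ℝ := Real.sqrt (1 + ‖x‖ ^ 2)

/-- The Schur-type norm of order `α` of an integral kernel, with values in `[0, ∞]`. -/
def schurNorm {d : ℕ} (α : ℝ) (K : Space d → Space d → ℂ) : ℝ≥0∞ :=
  max (⨆ x, ∫⁻ y, ‖K x y‖ₑ * ENNReal.ofReal (bracket (x - y) ^ α))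
    (⨆ y, ∫⁻ x, ‖K x y‖ₑ * ENNReal.ofReal (bracket (x - y) ^ α))

/-- Measurable kernels with off-diagonal polynomial decay of order `α`. -/
structure IsSchurKernel {d : ℕ} (α : ℝ) (K : Space d → Space d → ℂ) : Prop where
  aestronglyMeasurable :
    AEStronglyMeasurable (Function.uncurry K) (volume : Measure (Space d × Space d))
  finite : schurNorm α K < ∞

section SchurTest

variable {d : ℕ} {K : Space d → Space d → ℂ}

theorem lintegral_row_le (x : Space d) : ∫⁻ y, ‖K x y‖ₑ ≤ schurNorm 0 K := by
  refine le_trans ?_ (le_max_left _ _)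
  refine le_trans ?_ (le_iSup _ x)
  simp

theorem lintegral_col_le (y : Space d) : ∫⁻ x, ‖K x y‖ₑ ≤ schurNorm 0 K := by
  refine le_trans ?_ (le_max_right _ _)
  refine le_trans ?_ (le_iSup _ y)
  simp

theorem ae_row_sq_le (hK : IsSchurKernel 0 K) {u : Space d → ℂ}
    (hu : AEStronglyMeasurable u volume) :
    ∀ᵐ x : Space d, (∫⁻ y, ‖K x y * u y‖ₑ) ^ 2
      ≤ schurNorm 0 K * ∫⁻ y, ‖K x y‖ₑ * ‖u y‖ₑ ^ 2 := by
  filter_upwards [hK.aestronglyMeasurable.prodMk_left] with x hx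
  have hk : AEMeasurable (fun y => ‖K x y‖ₑ) volume := hx.enorm
  have hsq : ∀ a : ℝ≥0∞, (a ^ (1 / 2 : ℝ)) ^ (2 : ℝ) = a := fun a => by
    rw [← ENNReal.rpow_mul]; norm_num
  have hmul : ∀ a : ℝ≥0∞, a ^ (1 / 2 : ℝ) * a ^ (1 / 2 : ℝ) = a := fun a => by
    rw [← ENNReal.rpow_add_of_nonneg _ _ (by norm_num) (by norm_num)]; norm_num
  have h := ENNReal.lintegral_mul_le_Lp_mul_Lq (volume : Measure (Space d))
    (Real.HolderConjugate.two_two) (hk.pow_const (1 / 2 : ℝ))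
    ((hk.pow_const (1 / 2 : ℝ)).mul hu.enorm)
  have e1 : (∫⁻ y, ‖K x y * u y‖ₑ) = ∫⁻ y, ((fun y => ‖K x y‖ₑ ^ (1 / 2 : ℝ)) *
      ((fun y => ‖K x y‖ₑ ^ (1 / 2 : ℝ)) * fun y => ‖u y‖ₑ)) y := by
    refine lintegral_congr fun y => ?_
    simp only [Pi.mul_apply, ← mul_assoc, hmul, enorm_mul]
  have e2 : (∫⁻ y, ((fun y => ‖K x y‖ₑ ^ (1 / 2 : ℝ)) * fun y => ‖u y‖ₑ) y ^ (2 : ℝ))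
      = ∫⁻ y, ‖K x y‖ₑ * ‖u y‖ₑ ^ 2 := by
    refine lintegral_congr fun y => ?_
    rw [Pi.mul_apply, ENNReal.mul_rpow_of_nonneg _ _ (by norm_num), hsq]
    norm_num
  simp only [hsq] at h
  rw [e2] at h
  rw [e1, ← ENNReal.rpow_two]
  refine le_trans (ENNReal.rpow_le_rpow h (by norm_num)) ?_
  rw [ENNReal.mul_rpow_of_nonneg _ _ (by norm_num), hsq, hsq]
  exact mul_le_mul_left (lintegral_row_le x) _

theorem lintegral_sq_le (hK : IsSchurKernel 0 K) {u : Space d → ℂ}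
    (hu : AEStronglyMeasurable u volume) :
    ∫⁻ x, (∫⁻ y, ‖K x y * u y‖ₑ) ^ 2 ≤ schurNorm 0 K ^ 2 * ∫⁻ y, ‖u y‖ₑ ^ 2 := by
  have hm : AEMeasurable (Function.uncurry fun x y => ‖K x y‖ₑ * ‖u y‖ₑ ^ 2)
      ((volume : Measure (Space d)).prod volume) :=
    hK.aestronglyMeasurable.enorm.mul
      ((hu.comp_quasiMeasurePreserving Measure.quasiMeasurePreserving_snd).enorm.pow_const 2)
  have hN : schurNorm 0 K ≠ ∞ := hK.finite.ne
  calc ∫⁻ x, (∫⁻ y, ‖K x y * u y‖ₑ) ^ 2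
      ≤ ∫⁻ x, schurNorm 0 K * ∫⁻ y, ‖K x y‖ₑ * ‖u y‖ₑ ^ 2 :=
        lintegral_mono_ae (ae_row_sq_le hK hu)
    _ = schurNorm 0 K * ∫⁻ y, ∫⁻ x, ‖K x y‖ₑ * ‖u y‖ₑ ^ 2 := by
        rw [lintegral_const_mul' _ _ hN, lintegral_lintegral_swap hm]
    _ ≤ schurNorm 0 K * ∫⁻ y, schurNorm 0 K * ‖u y‖ₑ ^ 2 := by
        refine mul_le_mul_right (lintegral_mono fun y => ?_) _
        rw [lintegral_mul_const' _ _ (by simp)]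
        exact mul_le_mul_left (lintegral_col_le y) _
    _ = schurNorm 0 K ^ 2 * ∫⁻ y, ‖u y‖ₑ ^ 2 := by
        rw [lintegral_const_mul' _ _ hN, ← mul_assoc, sq]

theorem lintegral_enorm_sq (u : L2 d) : ∫⁻ y, ‖u y‖ₑ ^ 2 = ‖u‖ₑ ^ 2 := by
  rw [Lp.enorm_def, eLpNorm_eq_lintegral_rpow_enorm_toReal (by norm_num) (by norm_num)]
  simp only [ENNReal.toReal_ofNat, ENNReal.rpow_two]
  rw [← ENNReal.rpow_two, ← ENNReal.rpow_mul]
  norm_num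

theorem ae_integrable (hK : IsSchurKernel 0 K) (u : L2 d) :
    ∀ᵐ x : Space d, Integrable (fun y => K x y * u y) volume := by
  have hu := Lp.aestronglyMeasurable u
  have hm : AEStronglyMeasurable (Function.uncurry fun x y => K x y * u y)
      ((volume : Measure (Space d)).prod volume) :=
    hK.aestronglyMeasurable.mul
      (hu.comp_quasiMeasurePreserving Measure.quasiMeasurePreserving_snd)
  have hfin : ∫⁻ x, (∫⁻ y, ‖K x y * u y‖ₑ) ^ 2 ≠ ∞ := by
    refine ((lintegral_sq_le hK hu).trans_lt ?_).ne
    rw [lintegral_enorm_sq]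
    exact ENNReal.mul_lt_top (ENNReal.pow_lt_top hK.finite) (ENNReal.pow_lt_top (by simp))
  have hmeas : AEMeasurable (fun x => (∫⁻ y, ‖K x y * u y‖ₑ) ^ 2) (volume : Measure (Space d)) :=
    (AEMeasurable.lintegral_prod_right' hm.enorm).pow_const 2
  filter_upwards [hm.prodMk_left, ae_lt_top' hmeas hfin] with x hx hx'
  refine ⟨hx, ?_⟩
  rw [hasFiniteIntegral_iff_enorm]
  exact (ENNReal.pow_lt_top_iff.mp hx').resolve_right (by norm_num)

theorem eLpNorm_integral_le (hK : IsSchurKernel 0 K) (u : L2 d) :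
    eLpNorm (fun x => ∫ y, K x y * u y) 2 (volume : Measure (Space d))
      ≤ schurNorm 0 K * ‖u‖ₑ := by
  have hu := Lp.aestronglyMeasurable u
  rw [eLpNorm_eq_lintegral_rpow_enorm_toReal (by norm_num) (by norm_num)]
  simp only [ENNReal.toReal_ofNat, ENNReal.rpow_two]
  have h : ∫⁻ x, ‖∫ y, K x y * u y‖ₑ ^ 2 ≤ (schurNorm 0 K * ‖u‖ₑ) ^ 2 := by
    rw [mul_pow, ← lintegral_enorm_sq]
    refine le_trans (lintegral_mono fun x => ?_) (lintegral_sq_le hK hu)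
    exact pow_le_pow_left₀ (by simp) (enorm_integral_le_lintegral_enorm _) 2
  refine le_trans (ENNReal.rpow_le_rpow h (by norm_num)) ?_
  rw [← ENNReal.rpow_two, ← ENNReal.rpow_mul]
  norm_num

theorem memLp_integral (hK : IsSchurKernel 0 K) (u : L2 d) :
    MemLp (fun x => ∫ y, K x y * u y) 2 (volume : Measure (Space d)) := by
  have hu := Lp.aestronglyMeasurable u
  have hm : AEStronglyMeasurable (Function.uncurry fun x y => K x y * u y)
      ((volume : Measure (Space d)).prod volume) :=
    hK.aestronglyMeasurable.mul
      (hu.comp_quasiMeasurePreserving Measure.quasiMeasurePreserving_snd)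
  refine ⟨hm.integral_prod_right', (eLpNorm_integral_le hK u).trans_lt ?_⟩
  exact ENNReal.mul_lt_top hK.finite (by simp)

/-- The bounded operator `(T_K u)(x) = ∫ K(x,y) u(y) dy` on `L²(ℝ^d)`, for a kernel with finite
Schur norm of order `0`. -/
def schurOp (K : Space d → Space d → ℂ) (hK : IsSchurKernel 0 K) : L2 d →L[ℂ] L2 d :=
  LinearMap.mkContinuous
    { toFun := fun u => (memLp_integral hK u).toLp _
      map_add' := fun u v => by
        rw [← MemLp.toLp_add]
        refine MemLp.toLp_congr _ _ ?_
        filter_upwards [ae_integrable hK u, ae_integrable hK v] with x hx hx'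
        rw [Pi.add_apply, ← integral_add hx hx']
        refine integral_congr_ae ?_
        filter_upwards [Lp.coeFn_add u v] with y hy
        simp only [hy, Pi.add_apply, mul_add]
      map_smul' := fun c u => by
        rw [RingHom.id_apply, ← MemLp.toLp_const_smul]
        refine MemLp.toLp_congr _ _ (ae_of_all _ fun x => ?_)
        simp only [Pi.smul_apply, smul_eq_mul]
        rw [← integral_const_mul]
        refine integral_congr_ae ?_
        filter_upwards [Lp.coeFn_smul c u] with y hy
        simp only [hy, Pi.smul_apply, smul_eq_mul]
        ring }
    (schurNorm 0 K).toReal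
    (fun u => by
      simp only [LinearMap.coe_mk, AddHom.coe_mk, Lp.norm_toLp]
      refine le_trans (ENNReal.toReal_mono ?_ (eLpNorm_integral_le hK u)) ?_
      · exact (ENNReal.mul_lt_top hK.finite (by simp)).ne
      · simp [ENNReal.toReal_mul])

end SchurTest

open Classical in
/-- The integral operator `T_K` on `L²(ℝ^d)`; the value `0` is used only for kernels that are not
measurable or whose Schur norm of order `0` is infinite. -/
def kernelOp {d : ℕ} (K : Space d → Space d → ℂ) : L2 d →L[ℂ] L2 d :=
  if hK : IsSchurKernel 0 K then schurOp K hK else 0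

theorem kernelOp_apply {d : ℕ} {K : Space d → Space d → ℂ} (hK : IsSchurKernel 0 K) (u : L2 d) :
    kernelOp K u =ᵐ[volume] fun x => ∫ y, K x y * u y := by
  rw [kernelOp, dif_pos hK]
  exact (memLp_integral hK u).coeFn_toLp

/-- The operator `c Id + T_K`: the algebra of operators with off-diagonal decay contains, by
definition, the identity. -/
def decayOp {d : ℕ} (c : ℂ) (K : Space d → Space d → ℂ) : L2 d →L[ℂ] L2 d :=
  c • (1 : L2 d →L[ℂ] L2 d) + kernelOp K

/-- The components `B_{jk} = ∂_j A_k - ∂_k A_j` of the magnetic field `B = dA`. -/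
def magneticField {d : ℕ} (A : Space d → Space d) (x : Space d) (j k : Fin d) : ℝ :=
  fderiv ℝ A x (EuclideanSpace.single j 1) k - fderiv ℝ A x (EuclideanSpace.single k 1) j

/-- The flux `Φ^B(x,y,z)` of the two-form `B` through the oriented triangle with vertices
`x`, `y`, `z`. -/
def flux {d : ℕ} (B : Space d → Fin d → Fin d → ℝ) (x y z : Space d) : ℝ :=
  ∑ j, ∑ k, (y j - x j) * (z k - y k) *
    ∫ t in (0 : ℝ)..1, ∫ s in (0 : ℝ)..t, B (x + t • (y - x) + s • (z - y)) j k

/-- The phase `φ^A(x,y) = -Φ^B(0,x,y)`, `B = dA`. -/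
def phase {d : ℕ} (A : Space d → Space d) (x y : Space d) : ℝ :=
  -flux (magneticField A) 0 x y

/-- The phase `φ^{A_ε}(x,y) = -ε Φ^{B_ε}(0,x,y)` of the slowly varying potential
`A_ε(x) = A(εx)`, where `B_ε(x) = (dA)(εx)`. -/
def slowPhase {d : ℕ} (A : Space d → Space d) (ε : ℝ) (x y : Space d) : ℝ :=
  -ε * flux (fun z => magneticField A (ε • z)) 0 x y

/-- The kernel `e^{iφ(x,y)} K(x,y)`. -/
def twist {d : ℕ} (φ : Space d → Space d → ℝ) (K : Space d → Space d → ℂ) (x y : Space d) : ℂ :=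
  Complex.exp (Complex.I * (φ x y : ℂ)) * K x y

/-- The upper spectral edge `sup σ(T)` of a self-adjoint operator. -/
def upperEdge {d : ℕ} (T : L2 d →L[ℂ] L2 d) : ℝ := sSup (spectrum ℝ T)

/-- `E(ε)`, the upper edge of `c Id + T_{K_{εA}}`, where `φ^{εA} = ε φ^A`. -/
def edge {d : ℕ} (A : Space d → Space d) (c : ℂ) (K : Space d → Space d → ℂ) (ε : ℝ) : ℝ :=
  upperEdge (decayOp c (twist (fun x y => ε * phase A x y) K))

/-- `E_ε`, the upper edge of `c Id + T_{K_{A_ε}}`. -/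
def slowEdge {d : ℕ} (A : Space d → Space d) (c : ℂ) (K : Space d → Space d → ℂ) (ε : ℝ) : ℝ :=
  upperEdge (decayOp c (twist (slowPhase A ε) K))

/-- `A` is a `C¹` vector potential whose magnetic field has components bounded by `M`. -/
structure HasBoundedField {d : ℕ} (M : ℝ) (A : Space d → Space d) : Prop where
  contDiff : ContDiff ℝ 1 A
  bound : ∀ x j k, |magneticField A x j k| ≤ M

/-- The components of `dA` have first order partial derivatives, bounded by `M`. -/
structure HasBoundedFieldDeriv {d : ℕ} (M : ℝ) (A : Space d → Space d) : Prop where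
  differentiable : ∀ j k, Differentiable ℝ fun x => magneticField A x j k
  bound : ∀ x j k l,
    |fderiv ℝ (fun z => magneticField A z j k) x (EuclideanSpace.single l 1)| ≤ M

end MagneticEdge

end

open MeasureTheory Set Filter Topology
open scoped ENNReal ComplexConjugate

noncomputable section

namespace MagneticEdge

/-! ### Spectral edge and quadratic forms -/

section Hilbert

variable {H : Type*} [NormedAddCommGroup H] [InnerProductSpace ℂ H] [CompleteSpace H]

/-! The upper edge is the best constant `E` in `⟨u, T u⟩ ≤ E ‖u‖²`, so an upper bound for the edge
of a twisted operator can be proved by testing the untwisted one on suitable functions. Test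
functions are localized at scale `R` around a point `z` and put in the gauge based at `z`: `W_z(x) =
e^{iφ(z,x)} tent_R(x - z)`. By Stokes' theorem on triangles the phases satisfy `φ(x,z) + φ(z,y) =
φ(x,y) + Φ(x,y,z)` (`phase_add_phase`). Averaging the form of `K` at `W_z u` over `z` therefore
produces the form of `m(x,y) e^{iφ(x,y)} K(x,y)`, where `m = avgPhase` is a weighted mean of
`e^{iΦ(x,y,z)}` over `z` (`FormBound.avgPhase_mul_twist`). This form has the same upper bound as
that of `K`, and what remains is the size of `m - 1`, weighed against the decay of `K` by Schur's
test (`FormBound.perturb`).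

The missing mass of the weights is only of order `|x-y|²/R²`, because it equals half of a squared
`L²` distance. For a field of size `h` the flux is of order `h |x-y| R`; with `R = h^{-1/2}` its
square is `h |x-y|²`, which is harmless for a kernel with two moments. The first order term in the
flux is of order `h^{1/2} |x-y|` and must cancel.

If the field varies slowly, it nearly cancels under the reflection `z ↦ x + y - z`, which preserves
the weights (`abs_flux_add_flux_reflect_le`). This gives the Lipschitz bounds of (iii) directly
(`abs_upperEdge_twist_phase_sub_le`).

For a general bounded field one averages instead over the two potentials `±hA`. The first order
terms cancel exactly, but the result is only approximate midpoint convexity of the edge as a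
function `f` of the field strength, `f(s) ≤ (f(s+h) + f(s-h))/2 + P|h|^{α/2}` (`edge_le_midpoint`).
Taking `s = h = 2^k ε` and iterating up to `2^n |ε| ≈ 1` bounds `f(ε) - f(0)`; applying the same to
`t ↦ f(ε - t)` bounds it from below. The errors form a geometric series of ratio `2^{α/2-1}`, which
converges for `α < 2` and gives (i). At `α = 2` the ratio is `1`, and the number of terms is the
logarithm in (ii). -/

/-- The supremum of the spectrum of a self-adjoint operator is the best upper bound of its
quadratic form. -/
theorem sSup_spectrum_le_iff [Nontrivial H] {T : H →L[ℂ] H} (hT : IsSelfAdjoint T) {E : ℝ} :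
    sSup (spectrum ℝ T) ≤ E ↔ ∀ u, (inner ℂ u (T u)).re ≤ E * ‖u‖ ^ 2 := by
  have hne : (spectrum ℝ T).Nonempty := ContinuousFunctionalCalculus.spectrum_nonempty T hT
  have hb : BddAbove (spectrum ℝ T) :=
    (ContinuousFunctionalCalculus.isCompact_spectrum T).bddAbove
  rw [csSup_le_iff hb hne, ← le_algebraMap_iff_spectrum_le hT,
    ContinuousLinearMap.le_def, ContinuousLinearMap.isPositive_def']
  have hsa : IsSelfAdjoint (algebraMap ℝ (H →L[ℂ] H) E - T) :=
    (IsSelfAdjoint.algebraMap _ (IsSelfAdjoint.all E)).sub hT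
  have key : ∀ u, (algebraMap ℝ (H →L[ℂ] H) E - T).reApplyInnerSelf u
      = E * ‖u‖ ^ 2 - (inner ℂ u (T u)).re := by
    intro u
    have e : (inner ℂ (T u) u).re = (inner ℂ u (T u)).re := by
      exact inner_re_symm (𝕜 := ℂ) _ _
    have e2 : ((E • (1 : H →L[ℂ] H)) u) = (E : ℂ) • u := by simp
    rw [ContinuousLinearMap.reApplyInnerSelf_apply, _root_.sub_apply, inner_sub_left,
      Algebra.algebraMap_eq_smul_one, e2, inner_smul_left, inner_self_eq_norm_sq_to_K]
    simp [e, ← Complex.ofReal_pow]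
  refine ⟨fun h u => ?_, fun h => ⟨hsa, fun u => ?_⟩⟩
  · have := h.2 u
    rw [key] at this; linarith
  · rw [key]; linarith [h u]

end Hilbert

/-- On a trivial space the spectrum would be empty, and its `sSup` the default value `0`, which need
not be the best form bound. -/
instance (d : ℕ) : Nontrivial (L2 d) := by
  refine ⟨⟨indicatorConstLp 2 (measurableSet_ball (x := (0 : Space d)) (ε := 1))
    measure_ball_lt_top.ne (1 : ℂ), 0, fun h => ?_⟩⟩
  have h' := congrArg norm h
  rw [norm_indicatorConstLp (by norm_num) (by norm_num), norm_zero] at h'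
  have : 0 < (volume : Measure (Space d)).real (Metric.ball 0 1) :=
    ENNReal.toReal_pos (Metric.measure_ball_pos _ _ one_pos).ne' measure_ball_lt_top.ne
  have h2 := Real.rpow_pos_of_pos this (1 / (2 : ℝ≥0∞).toReal)
  rw [norm_one, one_mul] at h'
  linarith

/-- The upper edge of a self-adjoint operator is the best upper bound of its quadratic form. -/
theorem upperEdge_le_iff {d : ℕ} {T : L2 d →L[ℂ] L2 d} (hT : IsSelfAdjoint T) {E : ℝ} :
    upperEdge T ≤ E ↔ ∀ u, (inner ℂ u (T u)).re ≤ E * ‖u‖ ^ 2 := by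
  rw [← sSup_spectrum_le_iff hT, upperEdge]
  exact Iff.rfl

/-! ### Calculus of Schur kernels and their operators -/

section Kernels

variable {d : ℕ} {K K' : Space d → Space d → ℂ}

theorem one_le_bracket (x : Space d) : 1 ≤ bracket x := by
  rw [bracket, Real.one_le_sqrt]; nlinarith [sq_nonneg ‖x‖]

theorem bracket_neg (x : Space d) : bracket (-x) = bracket x := by
  simp [bracket]

theorem bracket_sub_comm (x y : Space d) : bracket (x - y) = bracket (y - x) := by
  rw [← bracket_neg, neg_sub]

theorem norm_le_bracket (x : Space d) : ‖x‖ ≤ bracket x := by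
  rw [bracket]; apply Real.le_sqrt_of_sq_le; linarith

/-- Allowing different weights on the two sides lets a factor of size `κ ⟨x-y⟩^α` be paid for by the
decay of the kernel. -/
theorem schurNorm_le_of_enorm_le {κ : ℝ≥0∞} {α β : ℝ}
    (h : ∀ x y, ‖K' x y‖ₑ * ENNReal.ofReal (bracket (x - y) ^ β)
      ≤ κ * (‖K x y‖ₑ * ENNReal.ofReal (bracket (x - y) ^ α))) (hκ : κ ≠ ∞) :
    schurNorm β K' ≤ κ * schurNorm α K := by
  refine max_le (iSup_le fun x => ?_) (iSup_le fun y => ?_)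
  · refine (lintegral_mono fun y => h x y).trans ?_
    rw [lintegral_const_mul' _ _ hκ]
    gcongr
    exact (le_iSup (fun x => ∫⁻ y, ‖K x y‖ₑ * ENNReal.ofReal (bracket (x - y) ^ α)) x).trans
      (le_max_left _ _)
  · refine (lintegral_mono fun x => h x y).trans ?_
    rw [lintegral_const_mul' _ _ hκ]
    gcongr
    exact (le_iSup (fun y => ∫⁻ x, ‖K x y‖ₑ * ENNReal.ofReal (bracket (x - y) ^ α)) y).trans
      (le_max_right _ _)

theorem schurNorm_mono {α β : ℝ} (h : α ≤ β) : schurNorm α K ≤ schurNorm β K := by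
  rw [← one_mul (schurNorm β K)]
  refine schurNorm_le_of_enorm_le (fun x y => ?_) ENNReal.one_ne_top
  rw [one_mul]
  gcongr
  exact one_le_bracket _

theorem IsSchurKernel.mono {α β : ℝ} (hK : IsSchurKernel β K) (h : α ≤ β) : IsSchurKernel α K :=
  ⟨hK.aestronglyMeasurable, (schurNorm_mono h).trans_lt hK.finite⟩

theorem schurNorm_twist (α : ℝ) (φ : Space d → Space d → ℝ) :
    schurNorm α (twist φ K) = schurNorm α K := by
  have : ∀ x y, ‖twist φ K x y‖ₑ = ‖K x y‖ₑ := fun x y => by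
    rw [twist, enorm_mul, mul_comm Complex.I, ← ofReal_norm, Complex.norm_exp_ofReal_mul_I]; simp
  simp only [schurNorm, this]

theorem IsSchurKernel.twist {α : ℝ} (hK : IsSchurKernel α K) {φ : Space d → Space d → ℝ}
    (hφ : Continuous (Function.uncurry φ)) : IsSchurKernel α (twist φ K) := by
  refine ⟨?_, by rw [schurNorm_twist]; exact hK.finite⟩
  refine AEStronglyMeasurable.mul (f := fun p : Space d × Space d =>
    Complex.exp (Complex.I * (φ p.1 p.2 : ℂ))) ?_ hK.aestronglyMeasurable
  exact (Complex.continuous_exp.comp (continuous_const.mul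
    (Complex.continuous_ofReal.comp hφ))).aestronglyMeasurable

theorem twist_zero : twist (fun _ _ => 0) K = K := by
  ext x y; simp [twist]

theorem twist_twist (φ ψ : Space d → Space d → ℝ) :
    twist φ (twist ψ K) = twist (fun x y => φ x y + ψ x y) K := by
  ext x y
  simp only [twist, Complex.ofReal_add, mul_add, Complex.exp_add, mul_assoc]

theorem schurNorm_conj_swap (α : ℝ) :
    schurNorm α (fun x y => conj (K y x)) = schurNorm α K := by
  have : ∀ z : ℂ, ‖conj z‖ₑ = ‖z‖ₑ := fun z => by simp [← ofReal_norm]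
  simp only [schurNorm, this]
  rw [max_comm]
  simp only [bracket_sub_comm]

theorem IsSchurKernel.conj_swap {α : ℝ} (hK : IsSchurKernel α K) :
    IsSchurKernel α (fun x y => conj (K y x)) := by
  refine ⟨?_, by rw [schurNorm_conj_swap]; exact hK.finite⟩
  exact RCLike.continuous_conj.comp_aestronglyMeasurable
    (AEStronglyMeasurable.prod_swap (μ := volume) (ν := volume) hK.aestronglyMeasurable)

/-- Cauchy–Schwarz applies to `|u|` and `∫ |K(·,y) v(y)| dy`, the latter being in `L²` by Schur's
test. This is the absolute convergence behind every use of Fubini for forms. -/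
theorem integrable_form (hK : IsSchurKernel 0 K) (u v : L2 d) :
    Integrable (fun p : Space d × Space d => conj (u p.1) * (K p.1 p.2 * v p.2))
      (volume.prod volume) := by
  have hu := Lp.aestronglyMeasurable u
  have hv := Lp.aestronglyMeasurable v
  have hm : AEStronglyMeasurable (fun p : Space d × Space d => K p.1 p.2 * v p.2)
      (volume.prod volume) :=
    hK.aestronglyMeasurable.mul
      (hv.comp_quasiMeasurePreserving Measure.quasiMeasurePreserving_snd)
  have hm' : AEStronglyMeasurable
      (fun p : Space d × Space d => conj (u p.1) * (K p.1 p.2 * v p.2)) (volume.prod volume) :=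
    (RCLike.continuous_conj.comp_aestronglyMeasurable
      (hu.comp_quasiMeasurePreserving Measure.quasiMeasurePreserving_fst)).mul hm
  refine ⟨hm', ?_⟩
  rw [hasFiniteIntegral_iff_enorm, lintegral_prod _ hm'.enorm]
  have e : ∀ x : Space d, ∫⁻ y, ‖conj (u x) * (K x y * v y)‖ₑ
      = ‖u x‖ₑ * ∫⁻ y, ‖K x y * v y‖ₑ := fun x => by
    rw [← lintegral_const_mul' _ _ (by simp)]
    refine lintegral_congr fun y => ?_
    rw [enorm_mul, ← ofReal_norm (conj (u x)), RCLike.norm_conj, ofReal_norm]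
  simp only [e]
  refine (ENNReal.lintegral_mul_le_Lp_mul_Lq volume Real.HolderConjugate.two_two hu.enorm
    (AEMeasurable.lintegral_prod_right' hm.enorm)).trans_lt ?_
  simp only [ENNReal.rpow_two]
  refine ENNReal.mul_lt_top (ENNReal.rpow_lt_top_of_nonneg (by norm_num) ?_)
    (ENNReal.rpow_lt_top_of_nonneg (by norm_num) ?_)
  · rw [lintegral_enorm_sq]; exact (ENNReal.pow_lt_top (by simp)).ne
  · refine ((lintegral_sq_le hK hv).trans_lt ?_).ne
    rw [lintegral_enorm_sq]
    exact ENNReal.mul_lt_top (ENNReal.pow_lt_top hK.finite) (ENNReal.pow_lt_top (by simp))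

theorem inner_kernelOp (hK : IsSchurKernel 0 K) (u v : L2 d) :
    inner ℂ u (kernelOp K v)
      = ∫ p : Space d × Space d, conj (u p.1) * (K p.1 p.2 * v p.2) ∂(volume.prod volume) := by
  rw [integral_prod _ (integrable_form hK u v), L2.inner_def]
  refine integral_congr_ae ?_
  filter_upwards [kernelOp_apply hK v] with x hx
  rw [integral_const_mul, hx, RCLike.inner_apply, mul_comm]

theorem norm_kernelOp_le (hK : IsSchurKernel 0 K) : ‖kernelOp K‖ ≤ (schurNorm 0 K).toReal := by
  rw [kernelOp, dif_pos hK]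
  exact LinearMap.mkContinuous_norm_le _ ENNReal.toReal_nonneg _

theorem kernelOp_congr (hK : IsSchurKernel 0 K) (hK' : IsSchurKernel 0 K')
    (h : ∀ᵐ p : Space d × Space d ∂(volume.prod volume), K p.1 p.2 = K' p.1 p.2) :
    kernelOp K = kernelOp K' := by
  ext1 v
  refine ext_inner_left ℂ fun u => ?_
  rw [inner_kernelOp hK, inner_kernelOp hK']
  refine integral_congr_ae ?_
  filter_upwards [h] with p hp
  rw [hp]

theorem adjoint_kernelOp (hK : IsSchurKernel 0 K) :
    ContinuousLinearMap.adjoint (kernelOp K) = kernelOp (fun x y => conj (K y x)) := by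
  ext1 v
  refine ext_inner_left ℂ fun u => ?_
  rw [ContinuousLinearMap.adjoint_inner_right, ← inner_conj_symm, inner_kernelOp hK,
    inner_kernelOp hK.conj_swap, ← integral_conj, ← integral_prod_swap]
  refine integral_congr_ae (ae_of_all _ fun p => ?_)
  simp only [Prod.fst_swap, Prod.snd_swap, map_mul, RCLike.conj_conj]
  ring

end Kernels

/-! ### Self-adjointness of the twisted operators -/

section Hermitian

variable {d : ℕ} {K : Space d → Space d → ℂ}

theorem form_indicator_ae (K : Space d → Space d → ℂ) {s t : Set (Space d)} (hs : MeasurableSet s)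
    (ht : MeasurableSet t) (hs' : volume s ≠ ∞) (ht' : volume t ≠ ∞) :
    (fun p : Space d × Space d => conj (indicatorConstLp 2 hs hs' (1 : ℂ) p.1)
        * (K p.1 p.2 * indicatorConstLp 2 ht ht' (1 : ℂ) p.2)) =ᵐ[volume.prod volume]
      (s ×ˢ t).indicator (Function.uncurry K) := by
  have h1 := (Measure.quasiMeasurePreserving_fst (μ := (volume : Measure (Space d)))
    (ν := (volume : Measure (Space d)))).ae
    (indicatorConstLp_coeFn (p := 2) (hs := hs) (hμs := hs') (c := (1 : ℂ)))
  have h2 := (Measure.quasiMeasurePreserving_snd (μ := (volume : Measure (Space d)))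
    (ν := (volume : Measure (Space d)))).ae
    (indicatorConstLp_coeFn (p := 2) (hs := ht) (hμs := ht') (c := (1 : ℂ)))
  filter_upwards [h1, h2] with p hp1 hp2
  rw [hp1, hp2]
  by_cases h1 : p.1 ∈ s <;> by_cases h2 : p.2 ∈ t <;>
    simp [Set.indicator, h1, h2, Function.uncurry]

/-- A kernel whose form is a multiple of the inner product vanishes: the diagonal is null. -/
theorem ae_eq_zero_of_form_eq_smul_inner (hd : 0 < d)
    (hK : ∀ u v : L2 d, Integrable
      (fun p : Space d × Space d => conj (u p.1) * (K p.1 p.2 * v p.2)) (volume.prod volume))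
    {c : ℂ} (h : ∀ u v : L2 d,
      ∫ p : Space d × Space d, conj (u p.1) * (K p.1 p.2 * v p.2) ∂(volume.prod volume)
        = c * inner ℂ u v) :
    ∀ᵐ p : Space d × Space d ∂(volume.prod volume), K p.1 p.2 = 0 := by
  -- Indicators of disjoint sets are orthogonal, so the multiple of the inner product contributes
  -- nothing.
  have rect : ∀ s t : Set (Space d), MeasurableSet s → MeasurableSet t → volume s ≠ ∞ →
      volume t ≠ ∞ → Disjoint s t →
      ∫ p in s ×ˢ t, Function.uncurry K p ∂(volume.prod volume) = 0 := by
    intro s t hs ht hs' ht' hst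
    rw [← integral_indicator (hs.prod ht), ← integral_congr_ae (form_indicator_ae K hs ht hs' ht'),
      h, L2.inner_indicatorConstLp_eq_inner_setIntegral, setIntegral_indicatorConstLp hs,
      hst.symm.inter_eq]
    simp
  have key : ∀ U V : Set (Space d), MeasurableSet U → MeasurableSet V → volume U ≠ ∞ →
      volume V ≠ ∞ → Disjoint U V →
      ∀ᵐ p : Space d × Space d ∂(volume.prod volume), p ∈ U ×ˢ V → K p.1 p.2 = 0 := by
    intro U V hU hV hU' hV' hUV
    have hint : IntegrableOn (Function.uncurry K) (U ×ˢ V) (volume.prod volume) := by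
      rw [← integrable_indicator_iff (hU.prod hV)]
      exact (hK _ _).congr (form_indicator_ae K hU hV hU' hV')
    rw [← ae_restrict_iff' (hU.prod hV)]
    -- Rectangles form a π-system generating the product σ-algebra, so vanishing on rectangles
    -- extends to all measurable sets.
    have hzero : ∀ S : Set (Space d × Space d), MeasurableSet S →
        ∫ p in S, Function.uncurry K p ∂((volume.prod volume).restrict (U ×ˢ V)) = 0 := by
      have hr : ∀ s t : Set (Space d), MeasurableSet s → MeasurableSet t →
          ∫ p in s ×ˢ t, Function.uncurry K p ∂((volume.prod volume).restrict (U ×ˢ V)) = 0 := by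
        intro s t hs ht
        rw [Measure.restrict_restrict (hs.prod ht), Set.prod_inter_prod]
        exact rect _ _ (hs.inter hU) (ht.inter hV) (measure_inter_ne_top_of_right_ne_top hU')
          (measure_inter_ne_top_of_right_ne_top hV')
          (hUV.mono inter_subset_right inter_subset_right)
      intro S hS
      induction S, hS using MeasurableSpace.induction_on_inter generateFrom_prod.symm
        isPiSystem_prod with
      | empty => simp
      | basic S hS =>
        obtain ⟨s, hs, t, ht, rfl⟩ := hS
        exact hr s t hs ht
      | compl S hS ih =>
        have := integral_add_compl hS hint
        rw [ih, zero_add] at this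
        rw [this, ← setIntegral_univ, ← Set.univ_prod_univ]
        exact hr _ _ MeasurableSet.univ MeasurableSet.univ
      | iUnion f hdisj hf ih =>
        rw [integral_iUnion hf hdisj hint.integrableOn]
        simp [ih]
    have := ae_eq_zero_of_forall_setIntegral_eq_of_sigmaFinite
      (fun s _ _ => hint.integrableOn) (fun s hs _ => hzero s hs)
    exact this
  -- Points are null only in positive dimension; the slices of the diagonal are points.
  have : Nonempty (Fin d) := ⟨⟨0, hd⟩⟩
  have hdiag : ∀ᵐ p : Space d × Space d ∂(volume.prod volume), p.1 ≠ p.2 := by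
    rw [ae_iff]
    simp only [ne_eq, not_not]
    rw [Measure.measure_prod_null (measurableSet_eq_fun measurable_fst measurable_snd)]
    refine ae_of_all _ fun x => ?_
    have : Prod.mk x ⁻¹' {p : Space d × Space d | p.1 = p.2} = {x} := by
      ext y; simp [eq_comm]
    simp [this]
  -- The complement of the diagonal is covered by countably many products of disjoint basic open
  -- sets of finite measure.
  let b := TopologicalSpace.countableBasis (Space d)
  have hb := TopologicalSpace.isBasis_countableBasis (Space d)
  have hall : ∀ q ∈ {q : Set (Space d) × Set (Space d) | q ∈ b ×ˢ b ∧ volume q.1 ≠ ∞ ∧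
      volume q.2 ≠ ∞ ∧ Disjoint q.1 q.2}, ∀ᵐ p : Space d × Space d ∂(volume.prod volume),
      p ∈ q.1 ×ˢ q.2 → K p.1 p.2 = 0 := by
    rintro q ⟨hq, h1, h2, h3⟩
    exact key _ _ (hb.isOpen hq.1).measurableSet (hb.isOpen hq.2).measurableSet h1 h2 h3
  rw [← ae_ball_iff] at hall
  · filter_upwards [hall, hdiag] with p hp hne
    obtain ⟨U, V, hU, hV, hxU, hyV, hUV⟩ := t2_separation hne
    obtain ⟨U', hU', hxU', hsU⟩ := hb.exists_subset_of_mem_open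
      (⟨hxU, Metric.mem_ball_self one_pos⟩ : p.1 ∈ U ∩ Metric.ball p.1 1)
      (hU.inter Metric.isOpen_ball)
    obtain ⟨V', hV', hyV', hsV⟩ := hb.exists_subset_of_mem_open
      (⟨hyV, Metric.mem_ball_self one_pos⟩ : p.2 ∈ V ∩ Metric.ball p.2 1)
      (hV.inter Metric.isOpen_ball)
    refine hp (U', V') ⟨⟨hU', hV'⟩, ?_, ?_, ?_⟩ ⟨hxU', hyV'⟩
    · exact ((measure_mono (hsU.trans inter_subset_right)).trans_lt measure_ball_lt_top).ne
    · exact ((measure_mono (hsV.trans inter_subset_right)).trans_lt measure_ball_lt_top).ne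
    · exact hUV.mono (hsU.trans inter_subset_left) (hsV.trans inter_subset_left)
  · exact ((TopologicalSpace.countable_countableBasis _).prod
      (TopologicalSpace.countable_countableBasis _)).mono fun q hq => hq.1

/-- Twisting by a continuous antisymmetric phase preserves self-adjointness. -/
theorem isSelfAdjoint_decayOp_twist {c : ℂ} (hK : IsSchurKernel 0 K)
    (hsa : IsSelfAdjoint (decayOp c K)) {φ : Space d → Space d → ℝ}
    (hφ : Continuous (Function.uncurry φ)) (hanti : ∀ x y, φ y x = -φ x y) :
    IsSelfAdjoint (decayOp c (twist φ K)) := by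
  rcases Nat.eq_zero_or_pos d with rfl | hd
  -- On a one-point space the diagonal is not null, but there antisymmetry forces the phase to
  -- vanish.
  · have : φ = fun _ _ => 0 := by
      ext x y
      rw [Subsingleton.elim y x]
      linarith [hanti x x]
    rw [this, twist_zero]
    exact hsa
  have hadj : ∀ {L : Space d → Space d → ℂ}, IsSchurKernel 0 L →
      star (decayOp c L) = conj c • 1 + kernelOp (fun x y => conj (L y x)) := by
    intro L hL
    rw [decayOp, star_add, star_smul, star_one, ← adjoint_kernelOp hL]
    rfl
  have h1 := hsa.star_eq
  rw [hadj hK, decayOp] at h1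
  -- Self-adjointness says that the form of `K - K*` is `conj c - c` times the inner product; such a
  -- kernel vanishes, so `K` is Hermitian almost everywhere.
  have hae : ∀ᵐ p : Space d × Space d ∂(volume.prod volume), K p.1 p.2 - conj (K p.2 p.1) = 0 := by
    have hform : ∀ u v : L2 d, (fun p : Space d × Space d =>
        conj (u p.1) * ((K p.1 p.2 - conj (K p.2 p.1)) * v p.2))
        = fun p => conj (u p.1) * (K p.1 p.2 * v p.2)
          - conj (u p.1) * (conj (K p.2 p.1) * v p.2) := fun u v => by
      ext p; ring
    refine ae_eq_zero_of_form_eq_smul_inner (K := fun x y => K x y - conj (K y x)) hd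
      (fun u v => ?_) (c := conj c - c) (fun u v => ?_)
    · rw [hform]
      exact (integrable_form hK u v).sub (integrable_form hK.conj_swap u v)
    · rw [hform, integral_sub (integrable_form hK u v) (integrable_form hK.conj_swap u v),
        ← inner_kernelOp hK, ← inner_kernelOp hK.conj_swap, ← inner_sub_right,
        ← inner_smul_right]
      congr 1
      have h2 := congrArg (fun T : L2 d →L[ℂ] L2 d => T v) h1
      simp only [_root_.add_apply, _root_.smul_apply, one_apply_eq_self] at h2
      rw [sub_smul, sub_eq_sub_iff_add_eq_add, add_comm, ← h2, add_comm]
  -- With `K` Hermitian the kernel operators cancel from the self-adjointness identity, leaving the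
  -- scalar parts.
  have hc : conj c • (1 : L2 d →L[ℂ] L2 d) = c • 1 := by
    rw [← kernelOp_congr hK hK.conj_swap (hae.mono fun p hp => sub_eq_zero.1 hp)] at h1
    exact add_right_cancel h1
  rw [isSelfAdjoint_iff, hadj (hK.twist hφ), hc, decayOp]
  congr 1
  refine kernelOp_congr (hK.twist hφ).conj_swap (hK.twist hφ) (hae.mono fun p hp => ?_)
  simp only [twist, map_mul, ← Complex.exp_conj, Complex.conj_I, Complex.conj_ofReal]
  rw [hanti p.1 p.2, sub_eq_zero.1 hp]
  simp

end Hermitian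

/-! ### Stokes' theorem on triangles and the cocycle identity for the phase -/

section Stokes

/-- Fubini on the unit square for `f` times the indicator of `s ≤ t`. -/
theorem integral_triangle_swap {f : ℝ → ℝ → ℝ} (hf : Continuous (Function.uncurry f)) :
    ∫ t in (0 : ℝ)..1, ∫ s in (0 : ℝ)..t, f t s = ∫ s in (0 : ℝ)..1, ∫ t in s..1, f t s := by
  have hint : IntegrableOn (Function.uncurry fun t s => {s | s ≤ t}.indicator (f t) s)
      (uIoc (0 : ℝ) 1 ×ˢ uIoc (0 : ℝ) 1) (volume.prod volume) := by
    have h1 : (Function.uncurry fun t s => {s | s ≤ t}.indicator (f t) s)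
        = {p : ℝ × ℝ | p.2 ≤ p.1}.indicator (Function.uncurry f) := by
      ext p; simp [Set.indicator, Function.uncurry]
    rw [h1]
    refine IntegrableOn.indicator ?_ (measurableSet_le measurable_snd measurable_fst)
    refine (hf.continuousOn.integrableOn_compact (K := Icc (0 : ℝ) 1 ×ˢ Icc (0 : ℝ) 1)
      (isCompact_Icc.prod isCompact_Icc)).mono_set ?_
    rw [uIoc_of_le zero_le_one]
    exact Set.prod_mono Ioc_subset_Icc_self Ioc_subset_Icc_self
  have h := intervalIntegral_intervalIntegral_swap hint
  calc _ = ∫ t in (0 : ℝ)..1, ∫ s in (0 : ℝ)..1, {s | s ≤ t}.indicator (f t) s := by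
        refine intervalIntegral.integral_congr fun t ht => ?_
        rw [uIcc_of_le zero_le_one] at ht
        exact (intervalIntegral.integral_indicator ht).symm
    _ = _ := h
    _ = _ := by
        refine intervalIntegral.integral_congr_ae (ae_of_all _ fun s hs => ?_)
        rw [uIoc_of_le zero_le_one] at hs
        have e : (fun t => {s | s ≤ t}.indicator (f t) s) = (Ici s).indicator fun t => f t s := by
          ext t; simp [Set.indicator]
        rw [e, intervalIntegral.integral_of_le zero_le_one, intervalIntegral.integral_of_le hs.2,
          setIntegral_indicator measurableSet_Ici, ← integral_Icc_eq_integral_Ioc]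
        congr 2
        ext t
        simp only [mem_inter_iff, mem_Ioc, mem_Ici, mem_Icc]
        exact ⟨fun h => ⟨h.2, h.1.2⟩, fun h => ⟨⟨hs.1.trans_le h.1, h.2⟩, h.1⟩⟩

variable {d : ℕ} {A : Space d → Space d}

/-- The integral of the one-form `A` along the segment from `x` to `y`. -/
def lineIntegral (A : Space d → Space d) (x y : Space d) : ℝ :=
  ∫ t in (0 : ℝ)..1, inner ℝ (A (x + t • (y - x))) (y - x)

theorem lineIntegral_swap (x y : Space d) : lineIntegral A y x = -lineIntegral A x y := by
  have h := intervalIntegral.integral_comp_sub_left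
    (fun t : ℝ => inner ℝ (A (x + t • (y - x))) (y - x)) (1 : ℝ) (a := 0) (b := 1)
  rw [sub_self, sub_zero] at h
  rw [lineIntegral, lineIntegral, ← h, ← intervalIntegral.integral_neg]
  refine intervalIntegral.integral_congr fun t _ => ?_
  rw [← inner_neg_right, neg_sub]
  congr 2
  module

theorem continuous_lineIntegral (hA : Continuous A) :
    Continuous (Function.uncurry (lineIntegral A)) := by
  refine intervalIntegral.continuous_parametric_intervalIntegral_of_continuous'
    (f := fun (p : Space d × Space d) t => inner ℝ (A (p.1 + t • (p.2 - p.1))) (p.2 - p.1)) ?_ 0 1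
  simp only [Function.uncurry_def]
  fun_prop

/-- The coordinate-free form of `dA(u, v)`: each of its two terms is a directional derivative of a
component of `A`, hence can be integrated exactly. -/
theorem sum_magneticField_mul (x u v : Space d) :
    ∑ j, ∑ k, u j * v k * magneticField A x j k
      = inner ℝ (fderiv ℝ A x u) v - inner ℝ (fderiv ℝ A x v) u := by
  have h : ∀ w : Space d, fderiv ℝ A x w
      = ∑ j, w j • fderiv ℝ A x (EuclideanSpace.single j 1) := fun w => by
    conv_lhs => rw [← (EuclideanSpace.basisFun (Fin d) ℝ).sum_repr w]
    simp [map_sum]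
  rw [h u, h v]
  simp only [sum_inner, inner_smul_left, PiLp.inner_apply, magneticField]
  simp only [Finset.mul_sum, mul_sub, Finset.sum_sub_distrib]
  congr 1
  · refine Finset.sum_congr rfl fun j _ => Finset.sum_congr rfl fun k _ => ?_
    simp; ring
  · rw [Finset.sum_comm]
    refine Finset.sum_congr rfl fun j _ => Finset.sum_congr rfl fun k _ => ?_
    simp; ring

theorem continuous_magneticField (hA : ContDiff ℝ 1 A) (j k : Fin d) :
    Continuous fun x => magneticField A x j k := by
  have h := hA.continuous_fderiv one_ne_zero
  unfold magneticField
  fun_prop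

theorem integral_triangle_sum {ι : Type*} [Fintype ι] (c : ι → ι → ℝ) {G : ι → ι → ℝ → ℝ → ℝ}
    (hG : ∀ j k, Continuous (Function.uncurry (G j k))) :
    ∫ t in (0 : ℝ)..1, ∫ s in (0 : ℝ)..t, ∑ j, ∑ k, c j k * G j k t s
      = ∑ j, ∑ k, c j k * ∫ t in (0 : ℝ)..1, ∫ s in (0 : ℝ)..t, G j k t s := by
  have hct : ∀ j k t, Continuous fun s : ℝ => c j k * G j k t s := fun j k t =>
    continuous_const.mul ((hG j k).comp (by fun_prop : Continuous fun s : ℝ => (t, s)))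
  have hi : ∀ j k, Continuous fun t : ℝ => c j k * ∫ s in (0 : ℝ)..t, G j k t s := fun j k =>
    continuous_const.mul
      (intervalIntegral.continuous_parametric_intervalIntegral_of_continuous (hG j k) continuous_id')
  have h1 : ∀ t : ℝ, ∫ s in (0 : ℝ)..t, ∑ j, ∑ k, c j k * G j k t s
      = ∑ j, ∑ k, c j k * ∫ s in (0 : ℝ)..t, G j k t s := by
    intro t
    rw [intervalIntegral.integral_finsetSum fun j _ =>
      (continuous_finsetSum _ fun k _ => hct j k t).intervalIntegrable _ _]
    refine Finset.sum_congr rfl fun j _ => ?_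
    rw [intervalIntegral.integral_finsetSum fun k _ => (hct j k t).intervalIntegrable _ _]
    simp only [intervalIntegral.integral_const_mul]
  simp only [h1]
  rw [intervalIntegral.integral_finsetSum fun j _ =>
      (continuous_finsetSum _ fun k _ => hi j k).intervalIntegrable _ _]
  refine Finset.sum_congr rfl fun j _ => ?_
  rw [intervalIntegral.integral_finsetSum fun k _ => (hi j k).intervalIntegrable _ _]
  simp only [intervalIntegral.integral_const_mul]

theorem flux_eq_integral (hA : ContDiff ℝ 1 A) (x y z : Space d) :
    flux (magneticField A) x y z = ∫ t in (0 : ℝ)..1, ∫ s in (0 : ℝ)..t,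
      (inner ℝ (fderiv ℝ A (x + t • (y - x) + s • (z - y)) (y - x)) (z - y)
        - inner ℝ (fderiv ℝ A (x + t • (y - x) + s • (z - y)) (z - y)) (y - x)) := by
  simp only [← sum_magneticField_mul]
  exact (integral_triangle_sum (fun j k => (y - x) j * (z - y) k)
    (G := fun j k t s => magneticField A (x + t • (y - x) + s • (z - y)) j k)
    fun j k => (continuous_magneticField hA j k).comp
    (by fun_prop : Continuous fun p : ℝ × ℝ => x + p.1 • (y - x) + p.2 • (z - y))).symm

/-- Stokes' theorem on a triangle. -/
theorem flux_eq_lineIntegral (hA : ContDiff ℝ 1 A) (x y z : Space d) :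
    flux (magneticField A) x y z
      = lineIntegral A x y + lineIntegral A y z - lineIntegral A x z := by
  rw [flux_eq_integral hA]
  set u := y - x with hu
  set v := z - y with hv
  have hcA : Continuous A := hA.continuous
  have hD := hA.continuous_fderiv one_ne_zero
  have hcP : Continuous (Function.uncurry fun t s : ℝ =>
      inner ℝ (fderiv ℝ A (x + t • u + s • v) u) v) := by
    simp only [Function.uncurry_def]; fun_prop
  have hcQ : Continuous (Function.uncurry fun t s : ℝ =>
      inner ℝ (fderiv ℝ A (x + t • u + s • v) v) u) := by
    simp only [Function.uncurry_def]; fun_prop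
  have hP : ∀ t s : ℝ, HasDerivAt (fun t : ℝ => inner ℝ (A (x + t • u + s • v)) v)
      (inner ℝ (fderiv ℝ A (x + t • u + s • v) u) v) t := by
    intro t s
    have hl : HasDerivAt (fun t : ℝ => x + t • u + s • v) u t := by
      simpa using (((hasDerivAt_id t).smul_const u).const_add x).add_const (s • v)
    have h1 := ((hA.differentiable one_ne_zero _).hasFDerivAt.comp_hasDerivAt t hl)
    simpa using h1.inner ℝ (hasDerivAt_const t v)
  have hQ : ∀ t s : ℝ, HasDerivAt (fun s : ℝ => inner ℝ (A (x + t • u + s • v)) u)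
      (inner ℝ (fderiv ℝ A (x + t • u + s • v) v) u) s := by
    intro t s
    have hl : HasDerivAt (fun s : ℝ => x + t • u + s • v) v s := by
      simpa using ((hasDerivAt_id s).smul_const v).const_add (x + t • u)
    have h1 := ((hA.differentiable one_ne_zero _).hasFDerivAt.comp_hasDerivAt s hl)
    simpa using h1.inner ℝ (hasDerivAt_const s u)
  -- The limit `t = 1` lies on the edge from `y` to `z`, the limit `t = s` on the edge from `x` to
  -- `z`. In `hQi` the limits `s = t` and `s = 0` lie on the edges from `x` to `z` and from `x` to
  -- `y`.
  have hPi : ∀ s : ℝ, ∫ t in s..1, inner ℝ (fderiv ℝ A (x + t • u + s • v) u) v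
      = inner ℝ (A (y + s • v)) v - inner ℝ (A (x + s • (u + v))) v := by
    intro s
    rw [intervalIntegral.integral_eq_sub_of_hasDerivAt (fun t _ => hP t s)
      ((hcP.comp (by fun_prop : Continuous fun t : ℝ => (t, s))).intervalIntegrable _ _)]
    simp [hu, smul_add, add_assoc]
  have hQi : ∀ t : ℝ, ∫ s in (0 : ℝ)..t, inner ℝ (fderiv ℝ A (x + t • u + s • v) v) u
      = inner ℝ (A (x + t • (u + v))) u - inner ℝ (A (x + t • u)) u := by
    intro t
    rw [intervalIntegral.integral_eq_sub_of_hasDerivAt (fun s _ => hQ t s)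
      ((hcQ.comp (by fun_prop : Continuous fun s : ℝ => (t, s))).intervalIntegrable _ _)]
    simp [smul_add, add_assoc]
  have hsub : ∀ t : ℝ, ∫ s in (0 : ℝ)..t, (inner ℝ (fderiv ℝ A (x + t • u + s • v) u) v
      - inner ℝ (fderiv ℝ A (x + t • u + s • v) v) u)
      = (∫ s in (0 : ℝ)..t, inner ℝ (fderiv ℝ A (x + t • u + s • v) u) v)
        - ∫ s in (0 : ℝ)..t, inner ℝ (fderiv ℝ A (x + t • u + s • v) v) u := fun t =>
    intervalIntegral.integral_sub
      ((hcP.comp (by fun_prop : Continuous fun s : ℝ => (t, s))).intervalIntegrable _ _)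
      ((hcQ.comp (by fun_prop : Continuous fun s : ℝ => (t, s))).intervalIntegrable _ _)
  simp only [hsub]
  rw [intervalIntegral.integral_sub
    ((intervalIntegral.continuous_parametric_intervalIntegral_of_continuous hcP
      continuous_id').intervalIntegrable _ _)
    ((intervalIntegral.continuous_parametric_intervalIntegral_of_continuous hcQ
      continuous_id').intervalIntegrable _ _), integral_triangle_swap hcP]
  simp only [hPi, hQi]
  have huv : z - x = u + v := by rw [hu, hv]; abel
  simp only [lineIntegral, huv, ← hu, ← hv, inner_add_right]
  rw [intervalIntegral.integral_sub, intervalIntegral.integral_sub, intervalIntegral.integral_add]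
  · ring
  all_goals exact Continuous.intervalIntegrable (by fun_prop) _ _

/-- The phase is minus the line integral of `A` along the segment, up to a gauge term `g(y) - g(x)`
with `g(x)` the integral of `A` from `0` to `x`. Continuity, antisymmetry and the cocycle identity
all come from this form. -/
theorem phase_eq (hA : ContDiff ℝ 1 A) (x y : Space d) :
    phase A x y = lineIntegral A 0 y - lineIntegral A 0 x - lineIntegral A x y := by
  rw [phase, flux_eq_lineIntegral hA]; ring

theorem continuous_phase (hA : ContDiff ℝ 1 A) : Continuous (Function.uncurry (phase A)) := by
  have h := continuous_lineIntegral hA.continuous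
  have e : Function.uncurry (phase A) = fun p => Function.uncurry (lineIntegral A) (0, p.2)
      - Function.uncurry (lineIntegral A) (0, p.1) - Function.uncurry (lineIntegral A) p := by
    ext p; exact phase_eq hA p.1 p.2
  rw [e]; fun_prop

theorem phase_swap (hA : ContDiff ℝ 1 A) (x y : Space d) : phase A y x = -phase A x y := by
  rw [phase_eq hA, phase_eq hA, lineIntegral_swap x y]; ring

/-- The gauge terms telescope and the line integrals close up around the triangle. The defect is a
flux, which depends only on the magnetic field and is small on small triangles. -/
theorem phase_add_phase (hA : ContDiff ℝ 1 A) (x y z : Space d) :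
    phase A x z + phase A z y = phase A x y + flux (magneticField A) x y z := by
  rw [phase_eq hA, phase_eq hA, phase_eq hA, flux_eq_lineIntegral hA, lineIntegral_swap y z]; ring

end Stokes

/-! ### Tent functions and averages over localization centres -/

section Tent

variable {d : ℕ} {R : ℝ}

/-- The tent function of radius `R`. -/
def tent (R : ℝ) (w : Space d) : ℝ := max 0 (1 - ‖w‖ / R)

theorem continuous_tent : Continuous (tent R : Space d → ℝ) := by
  unfold tent; fun_prop

theorem tent_nonneg (w : Space d) : 0 ≤ tent R w := le_max_left _ _

theorem tent_le_one (hR : 0 < R) (w : Space d) : tent R w ≤ 1 :=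
  max_le zero_le_one (by have := div_nonneg (norm_nonneg w) hR.le; linarith)

theorem tent_eq_zero (hR : 0 < R) {w : Space d} (hw : R ≤ ‖w‖) : tent R w = 0 :=
  max_eq_left (by have := (one_le_div hR).2 hw; linarith)

theorem tent_neg (w : Space d) : tent R (-w) = tent R w := by simp [tent]

theorem abs_tent_sub_le (hR : 0 < R) (v w : Space d) :
    |tent R v - tent R w| ≤ ‖v - w‖ / R := by
  refine (abs_max_sub_max_le_max _ _ _ _).trans ?_
  rw [sub_self, abs_zero, max_eq_right (abs_nonneg _)]
  have : 1 - ‖v‖ / R - (1 - ‖w‖ / R) = (‖w‖ - ‖v‖) / R := by ring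
  rw [this, abs_div, abs_of_pos hR, norm_sub_rev v w]
  gcongr
  exact abs_norm_sub_norm_le w v

theorem hasCompactSupport_tent (hR : 0 < R) : HasCompactSupport (tent R : Space d → ℝ) := by
  refine HasCompactSupport.intro (isCompact_closedBall 0 R) fun w hw => tent_eq_zero hR ?_
  rw [mem_closedBall_zero_iff, not_le] at hw
  exact hw.le

theorem hasCompactSupport_tent_sub (hR : 0 < R) (x : Space d) :
    HasCompactSupport fun z : Space d => tent R (x - z) :=
  (hasCompactSupport_tent hR).comp_homeomorph (Homeomorph.subLeft x)

theorem continuous_tent_sub (x : Space d) : Continuous fun z : Space d => tent R (x - z) :=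
  continuous_tent.comp (by fun_prop)

/-- The squared `L²` norm of the tent function. -/
def tentMass (d : ℕ) (R : ℝ) : ℝ := ∫ w : Space d, tent R w ^ 2

theorem integrable_tent_sub_mul (hR : 0 < R) (x : Space d) {q : Space d → ℝ} (hq : Continuous q) :
    Integrable fun z : Space d => tent R (x - z) * q z :=
  ((continuous_tent_sub x).mul hq).integrable_of_hasCompactSupport
    (hasCompactSupport_tent_sub hR x).mul_right

theorem integrable_tent_sub_sq (hR : 0 < R) (x : Space d) :
    Integrable fun z : Space d => tent R (x - z) ^ 2 := by
  simp only [sq]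
  exact integrable_tent_sub_mul hR x (continuous_tent_sub x)

theorem integral_tent_sub_sq (x : Space d) :
    ∫ z : Space d, tent R (x - z) ^ 2 = tentMass d R :=
  integral_sub_left_eq_self (fun w : Space d => tent R w ^ 2) volume x

theorem measureReal_closedBall_eq (x : Space d) {r : ℝ} (hr : 0 ≤ r) :
    (volume : Measure (Space d)).real (Metric.closedBall x r)
      = r ^ d * (volume : Measure (Space d)).real (Metric.ball 0 1) := by
  rw [measureReal_def, Measure.addHaar_closedBall _ _ hr, ENNReal.toReal_mul,
    ENNReal.toReal_ofReal (by positivity), finrank_euclideanSpace_fin, measureReal_def]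

/-- On the ball of radius `R/2` the tent is at least `1/2`; the factor `2^(d+2)` is `2^d` from the
radius times `4` from the square. -/
theorem measureReal_ball_le_tentMass (hR : 0 < R) :
    R ^ d * (volume : Measure (Space d)).real (Metric.ball 0 1) ≤ 2 ^ (d + 2) * tentMass d R := by
  have h1 : ∫ w : Space d, (Metric.closedBall (0 : Space d) (R / 2)).indicator (fun _ => (1 / 4 : ℝ)) w
      ≤ tentMass d R := by
    refine integral_mono ?_ ?_ fun w => ?_
    · exact (integrable_indicator_iff measurableSet_closedBall).2
        (integrableOn_const measure_closedBall_lt_top.ne)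
    · simpa [tent_neg] using integrable_tent_sub_sq hR (0 : Space d)
    · by_cases hw : w ∈ Metric.closedBall (0 : Space d) (R / 2)
      · rw [indicator_of_mem hw]
        rw [mem_closedBall_zero_iff] at hw
        have : ‖w‖ / R ≤ 1 / 2 := by rw [div_le_iff₀ hR]; linarith
        have h2 : 1 / 2 ≤ tent R w := (by linarith : (1 / 2 : ℝ) ≤ 1 - ‖w‖ / R).trans (le_max_right _ _)
        nlinarith
      · rw [indicator_of_notMem hw]; positivity
  rw [integral_indicator measurableSet_closedBall, setIntegral_const, smul_eq_mul,
    measureReal_closedBall_eq _ (by positivity), div_pow] at h1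
  calc _ = 2 ^ (d + 2) * (R ^ d / 2 ^ d * (volume : Measure (Space d)).real (Metric.ball 0 1)
        * (1 / 4)) := by
        rw [pow_add]; field_simp; norm_num
    _ ≤ _ := by gcongr

theorem tentMass_pos (hR : 0 < R) : 0 < tentMass d R := by
  have h := measureReal_ball_le_tentMass (d := d) hR
  have hb : 0 < (volume : Measure (Space d)).real (Metric.ball 0 1) :=
    ENNReal.toReal_pos (Metric.measure_ball_pos _ _ one_pos).ne' measure_ball_lt_top.ne
  have h2 : 0 < 2 ^ (d + 2) * tentMass d R := lt_of_lt_of_le (by positivity) h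
  exact pos_of_mul_pos_right h2 (by positivity)

/-- The tent is Lipschitz with constant `1/R`, and the difference is supported in two balls of
radius `R`, whose volume is controlled by the mass of the tent. -/
theorem integral_tent_sub_tent_sq_le (hR : 0 < R) (x y : Space d) :
    ∫ z : Space d, (tent R (x - z) - tent R (y - z)) ^ 2
      ≤ 2 ^ (d + 3) * (‖x - y‖ / R) ^ 2 * tentMass d R := by
  have hi : ∀ a : Space d, Integrable
      ((Metric.closedBall a R).indicator fun _ : Space d => (‖x - y‖ / R) ^ 2) := fun a =>
    (integrable_indicator_iff measurableSet_closedBall).2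
      (integrableOn_const measure_closedBall_lt_top.ne)
  have hv : ∀ a : Space d, ∫ z, (Metric.closedBall a R).indicator (fun _ => (‖x - y‖ / R) ^ 2) z
      = R ^ d * (volume : Measure (Space d)).real (Metric.ball 0 1) * (‖x - y‖ / R) ^ 2 := fun a => by
    rw [integral_indicator measurableSet_closedBall, setIntegral_const, smul_eq_mul,
      measureReal_closedBall_eq _ hR.le]
  have h1 : ∫ z : Space d, (tent R (x - z) - tent R (y - z)) ^ 2
      ≤ ∫ z, ((Metric.closedBall x R).indicator (fun _ => (‖x - y‖ / R) ^ 2) z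
        + (Metric.closedBall y R).indicator (fun _ => (‖x - y‖ / R) ^ 2) z) := by
    refine integral_mono_of_nonneg (ae_of_all _ fun z => sq_nonneg _) ((hi x).add (hi y))
      (ae_of_all _ fun z => ?_)
    have hb : (tent R (x - z) - tent R (y - z)) ^ 2 ≤ (‖x - y‖ / R) ^ 2 := by
      rw [← sq_abs]
      gcongr
      simpa using abs_tent_sub_le hR (x - z) (y - z)
    have hn : ∀ a : Space d,
        0 ≤ (Metric.closedBall a R).indicator (fun _ => (‖x - y‖ / R) ^ 2) z := fun a =>
      indicator_nonneg (fun _ _ => sq_nonneg _) _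
    have hm : ∀ a : Space d, z ∉ Metric.closedBall a R → tent R (a - z) = 0 := fun a ha => by
      refine tent_eq_zero hR ?_
      rw [Metric.mem_closedBall, dist_eq_norm, norm_sub_rev, not_le] at ha
      exact ha.le
    by_cases hx : z ∈ Metric.closedBall x R
    · have := hn y
      simp only [indicator_of_mem hx]
      linarith
    by_cases hy : z ∈ Metric.closedBall y R
    · have := hn x
      simp only [indicator_of_mem hy]
      linarith
    simp only [hm x hx, hm y hy, indicator_of_notMem hx, indicator_of_notMem hy]
    simp
  rw [integral_add (hi x) (hi y), hv, hv] at h1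
  refine h1.trans ?_
  have h2 := measureReal_ball_le_tentMass (d := d) hR
  have h3 : (2 : ℝ) ^ (d + 3) = 2 * 2 ^ (d + 2) := by ring
  rw [h3]
  nlinarith [mul_le_mul_of_nonneg_right h2 (sq_nonneg (‖x - y‖ / R))]

/-- The average of `q` with weight proportional to `z ↦ tent R (x - z) * tent R (y - z)`, normalized
to be a probability weight for `x = y`. -/
def locAvg (R : ℝ) (x y : Space d) (q : Space d → ℂ) : ℂ :=
  (tentMass d R : ℂ)⁻¹ * ∫ z, ((tent R (x - z) * tent R (y - z) : ℝ) : ℂ) * q z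

theorem integrable_tent_mul_tent_mul (hR : 0 < R) (x y : Space d) {q : Space d → ℂ}
    (hq : Continuous q) :
    Integrable fun z : Space d => ((tent R (x - z) * tent R (y - z) : ℝ) : ℂ) * q z := by
  refine Continuous.integrable_of_hasCompactSupport ?_ ?_
  · exact (Complex.continuous_ofReal.comp
      ((continuous_tent_sub x).mul (continuous_tent_sub y))).mul hq
  · refine HasCompactSupport.mul_right ?_
    exact ((hasCompactSupport_tent_sub hR x).mul_right
      (f' := fun z => tent R (y - z))).comp_left Complex.ofReal_zero

/-- The reflection `z ↦ x + y - z` exchanges the two tents. It allows `q` to be symmetrized, which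
removes its odd part. -/
theorem locAvg_reflect (x y : Space d) (q : Space d → ℂ) :
    locAvg R x y (fun z => q (x + y - z)) = locAvg R x y q := by
  rw [locAvg, locAvg, ← integral_sub_left_eq_self
    (fun z => ((tent R (x - z) * tent R (y - z) : ℝ) : ℂ) * q z) volume (x + y)]
  congr 2
  ext z
  have h1 : x - (x + y - z) = -(y - z) := by abel
  have h2 : y - (x + y - z) = -(x - z) := by abel
  rw [h1, h2, tent_neg, tent_neg, mul_comm (tent R (y - z))]

theorem locAvg_average (hR : 0 < R) (x y : Space d) {p q : Space d → ℂ} (hp : Continuous p)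
    (hq : Continuous q) :
    locAvg R x y (fun z => (p z + q z) / 2) = (locAvg R x y p + locAvg R x y q) / 2 := by
  rw [locAvg, locAvg, locAvg, ← mul_add, ← integral_add (integrable_tent_mul_tent_mul hR x y hp)
    (integrable_tent_mul_tent_mul hR x y hq), mul_div_assoc, ← integral_div]
  congr 2
  ext z
  ring

/-- Polarization. Since the lost mass is half of a squared distance, it is quadratic in `‖x - y‖ /
R`, whereas the Lipschitz bound alone would give a linear loss. -/
theorem integral_tent_mul_tent (hR : 0 < R) (x y : Space d) :
    ∫ z : Space d, tent R (x - z) * tent R (y - z)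
      = tentMass d R - (∫ z : Space d, (tent R (x - z) - tent R (y - z)) ^ 2) / 2 := by
  have hx := integrable_tent_sub_sq hR x
  have hy := integrable_tent_sub_sq hR y
  have hxy := integrable_tent_sub_mul hR x (continuous_tent_sub (R := R) y)
  have e : ∀ z, (tent R (x - z) - tent R (y - z)) ^ 2
      = tent R (x - z) ^ 2 + tent R (y - z) ^ 2 - 2 * (tent R (x - z) * tent R (y - z)) := fun z => by
    ring
  simp only [e]
  have hadd : Integrable fun z => tent R (x - z) ^ 2 + tent R (y - z) ^ 2 := hx.add hy
  rw [integral_sub hadd (hxy.const_mul 2), integral_add hx hy, integral_const_mul,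
    integral_tent_sub_sq, integral_tent_sub_sq]
  ring

theorem integral_tent_mul_tent_le (hR : 0 < R) (x y : Space d) :
    ∫ z : Space d, tent R (x - z) * tent R (y - z) ≤ tentMass d R := by
  rw [integral_tent_mul_tent hR]
  have : 0 ≤ ∫ z : Space d, (tent R (x - z) - tent R (y - z)) ^ 2 :=
    integral_nonneg fun z => sq_nonneg _
  linarith

theorem norm_locAvg_le (hR : 0 < R) (x y : Space d) {q : Space d → ℂ} {η : ℝ} (hη : 0 ≤ η)
    (h : ∀ z, ‖x - z‖ < R → ‖y - z‖ < R → ‖q z‖ ≤ η) : ‖locAvg R x y q‖ ≤ η := by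
  have hN := tentMass_pos (d := d) hR
  rw [locAvg, norm_mul, norm_inv, Complex.norm_real, Real.norm_of_nonneg hN.le,
    inv_mul_le_iff₀ hN, mul_comm]
  calc _ ≤ ∫ z : Space d, η * (tent R (x - z) * tent R (y - z)) := by
        refine norm_integral_le_of_norm_le
          ((integrable_tent_sub_mul hR x (continuous_tent_sub y)).const_mul η)
          (ae_of_all _ fun z => ?_)
        rw [norm_mul, Complex.norm_real,
          Real.norm_of_nonneg (mul_nonneg (tent_nonneg _) (tent_nonneg _)), mul_comm]
        rcases le_or_gt R ‖x - z‖ with hx | hx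
        · simp [tent_eq_zero hR hx]
        rcases le_or_gt R ‖y - z‖ with hy | hy
        · simp [tent_eq_zero hR hy]
        exact mul_le_mul_of_nonneg_right (h z hx hy) (mul_nonneg (tent_nonneg _) (tent_nonneg _))
    _ ≤ _ := by
        rw [integral_const_mul]
        exact mul_le_mul_of_nonneg_left (integral_tent_mul_tent_le hR x y) hη

/-- The two errors are the mass lost because the tents are centred at different points and the
deviation of `q` from `1`. -/
theorem norm_locAvg_sub_one_le (hR : 0 < R) (x y : Space d) {q : Space d → ℂ} (hq : Continuous q)
    {η : ℝ} (hη : 0 ≤ η) (h : ∀ z, ‖x - z‖ < R → ‖y - z‖ < R → ‖q z - 1‖ ≤ η) :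
    ‖locAvg R x y q - 1‖ ≤ 2 ^ (d + 2) * (‖x - y‖ / R) ^ 2 + η := by
  have hN := tentMass_pos (d := d) hR
  have hN' : (tentMass d R : ℂ) ≠ 0 := by exact_mod_cast hN.ne'
  have e : locAvg R x y q - 1 = locAvg R x y (fun z => q z - 1)
      - (((tentMass d R)⁻¹ * ((∫ z : Space d, (tent R (x - z) - tent R (y - z)) ^ 2) / 2) : ℝ) : ℂ) := by
    have h1 : ∫ z, ((tent R (x - z) * tent R (y - z) : ℝ) : ℂ) * (q z - 1)
        = (∫ z, ((tent R (x - z) * tent R (y - z) : ℝ) : ℂ) * q z)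
          - ((∫ z : Space d, tent R (x - z) * tent R (y - z) : ℝ) : ℂ) := by
      rw [← integral_complex_ofReal, ← integral_sub (integrable_tent_mul_tent_mul hR x y hq)]
      · congr 1; ext z; ring
      · exact (integrable_tent_sub_mul hR x (continuous_tent_sub y)).ofReal
    rw [locAvg, locAvg, h1, integral_tent_mul_tent hR]
    push_cast
    field_simp
    ring
  rw [e]
  refine (norm_sub_le _ _).trans ?_
  rw [add_comm]
  refine add_le_add ?_ (norm_locAvg_le hR x y hη h)
  have h0 : 0 ≤ ∫ z : Space d, (tent R (x - z) - tent R (y - z)) ^ 2 :=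
    integral_nonneg fun z => sq_nonneg _
  rw [Complex.norm_real, Real.norm_of_nonneg (by positivity), inv_mul_le_iff₀ hN]
  have := integral_tent_sub_tent_sq_le hR x y
  have h3 : (2 : ℝ) ^ (d + 3) = 2 * 2 ^ (d + 2) := by ring
  rw [h3] at this
  linarith

theorem norm_exp_I_mul_sub_one_sub_le (a : ℝ) :
    ‖Complex.exp (Complex.I * a) - 1 - Complex.I * a‖ ≤ 3 * a ^ 2 := by
  have hn : ‖Complex.I * (a : ℂ)‖ = |a| := by simp
  rcases le_or_gt |a| 1 with h | h
  · refine (Complex.norm_exp_sub_one_sub_id_le (by rw [hn]; exact h)).trans ?_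
    rw [hn, sq_abs]; nlinarith [sq_nonneg a]
  · refine (norm_sub_le _ _).trans ?_
    rw [hn]
    have h1 := Real.norm_exp_I_mul_ofReal_sub_one_le (x := a)
    rw [Real.norm_eq_abs] at h1
    nlinarith [sq_abs a]

/-- To first order only `a + b` enters, so nearly opposite phases leave a quadratic error. -/
theorem norm_average_exp_sub_one_le (a b : ℝ) :
    ‖(Complex.exp (Complex.I * a) + Complex.exp (Complex.I * b)) / 2 - 1‖
      ≤ |a + b| / 2 + 3 / 2 * (a ^ 2 + b ^ 2) := by
  have e : (Complex.exp (Complex.I * a) + Complex.exp (Complex.I * b)) / 2 - 1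
      = ((Complex.exp (Complex.I * a) - 1 - Complex.I * a)
        + (Complex.exp (Complex.I * b) - 1 - Complex.I * b) + Complex.I * ((a + b : ℝ) : ℂ)) / 2 := by
    push_cast; ring
  have hn : ‖Complex.I * ((a + b : ℝ) : ℂ)‖ = |a + b| := by
    rw [norm_mul, Complex.norm_I, one_mul, Complex.norm_real, Real.norm_eq_abs]
  rw [e, norm_div, Complex.norm_ofNat]
  have h1 := norm_add₃_le (a := Complex.exp (Complex.I * a) - 1 - Complex.I * a)
    (b := Complex.exp (Complex.I * b) - 1 - Complex.I * b) (c := Complex.I * ((a + b : ℝ) : ℂ))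
  rw [hn] at h1
  linarith [norm_exp_I_mul_sub_one_sub_le a, norm_exp_I_mul_sub_one_sub_le b]

end Tent

/-! ### Form bounds: localization, averaging, perturbation -/

section Localization

variable {d : ℕ} {R E : ℝ} {K L : Space d → Space d → ℂ}

/-- The quadratic form of the integral operator with kernel `K` is bounded above by `E`. -/
def FormBound (K : Space d → Space d → ℂ) (E : ℝ) : Prop :=
  ∀ u : L2 d, (inner ℂ u (kernelOp K u)).re ≤ E * ‖u‖ ^ 2

theorem upperEdge_decayOp_le_iff {c : ℂ} (hsa : IsSelfAdjoint (decayOp c K)) :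
    upperEdge (decayOp c K) ≤ E ↔ FormBound K (E - c.re) := by
  rw [upperEdge_le_iff hsa]
  refine forall_congr' fun u => ?_
  have h : (inner ℂ u (decayOp c K u)).re = c.re * ‖u‖ ^ 2 + (inner ℂ u (kernelOp K u)).re := by
    rw [decayOp, _root_.add_apply, inner_add_right, _root_.smul_apply, one_apply_eq_self,
      inner_smul_right, inner_self_eq_norm_sq_to_K, Complex.add_re]
    simp [← Complex.ofReal_pow]
  rw [h, sub_mul]
  constructor <;> intro h <;> linarith

theorem norm_sq_eq_integral (u : L2 d) : ‖u‖ ^ 2 = ∫ x, ‖u x‖ ^ 2 := by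
  have h : (inner ℂ u u) = ((∫ x, ‖u x‖ ^ 2 : ℝ) : ℂ) := by
    rw [L2.inner_def, ← integral_complex_ofReal]
    simp only [inner_self_eq_norm_sq_to_K]
    simp
  rw [inner_self_eq_norm_sq_to_K] at h
  exact Complex.ofReal_injective ((Complex.ofReal_pow _ 2).trans h)

theorem integrable_norm_sq (u : L2 d) : Integrable fun x => ‖u x‖ ^ 2 :=
  (Lp.memLp u).integrable_norm_pow two_ne_zero

theorem integrable_tent_sub (hR : 0 < R) (x : Space d) :
    Integrable fun z : Space d => tent R (x - z) := by
  simpa using integrable_tent_sub_mul hR x (continuous_const (y := (1 : ℝ)))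

/-- Each slice of `H` in `z` has `L¹` norm at most that of one tent, uniformly in `p`. It provides
the Fubini hypothesis for integrating over the centres. -/
theorem integrable_mul_of_norm_le_tent {𝕜 X : Type*} [RCLike 𝕜] [MeasurableSpace X] {μ : Measure X}
    [SFinite μ] (hR : 0 < R) {f : X → 𝕜} (hf : Integrable f μ) {H : X × Space d → 𝕜}
    (hH : AEStronglyMeasurable H (μ.prod volume)) {c : X → Space d}
    (hle : ∀ p z, ‖H (p, z)‖ ≤ tent R (c p - z)) :
    Integrable (fun q => f q.1 * H q) (μ.prod volume) := by
  have hm : AEStronglyMeasurable (fun q : X × Space d => f q.1 * H q) (μ.prod volume) :=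
    (hf.aestronglyMeasurable.comp_quasiMeasurePreserving
      Measure.quasiMeasurePreserving_fst).mul hH
  have hsec : ∀ᵐ p ∂μ, Integrable (fun z => H (p, z)) volume := by
    filter_upwards [hH.prodMk_left] with p hp
    exact (integrable_tent_sub hR (c p)).mono' hp (ae_of_all _ (hle p))
  refine (integrable_prod_iff hm).2 ⟨hsec.mono fun p hp => hp.const_mul (f p), ?_⟩
  refine (hf.norm.mul_const (∫ w : Space d, tent R w)).mono' hm.norm.integral_prod_right' ?_
  filter_upwards [hsec] with p hp
  rw [Real.norm_of_nonneg (integral_nonneg fun _ => norm_nonneg _)]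
  simp only [norm_mul]
  rw [integral_const_mul, ← integral_sub_left_eq_self (fun w : Space d => tent R w) volume (c p)]
  exact mul_le_mul_of_nonneg_left
    (integral_mono hp.norm (integrable_tent_sub hR (c p)) (hle p)) (norm_nonneg _)

/-- Averaging the form of `K` over the localized functions `W z * u`. -/
theorem FormBound.localize (hK : IsSchurKernel 0 K) (hE : FormBound K E) (hR : 0 < R)
    {W : Space d → Space d → ℂ} (hW : Continuous (Function.uncurry W))
    (hle : ∀ z x, ‖W z x‖ ≤ tent R (x - z))
    (hmass : ∀ x, ∫ z, ‖W z x‖ ^ 2 = tentMass d R) (hL : IsSchurKernel 0 L)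
    (hLK : ∀ x y, L x y = (tentMass d R : ℂ)⁻¹ * (∫ z, conj (W z x) * W z y) * K x y) :
    FormBound L E := by
  intro u
  have hN := tentMass_pos (d := d) hR
  have hle1 : ∀ z x, ‖W z x‖ ≤ 1 := fun z x => (hle z x).trans (tent_le_one hR _)
  have hWz : ∀ z, Continuous (W z) := fun z => hW.comp (by fun_prop : Continuous fun x => (z, x))
  set f : Space d × Space d → ℂ := fun p => conj (u p.1) * (K p.1 p.2 * u p.2) with hf
  set H : (Space d × Space d) × Space d → ℂ := fun q => conj (W q.2 q.1.1) * W q.2 q.1.2 with hH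
  have hHc : Continuous H := by
    refine (RCLike.continuous_conj.comp (hW.comp (by fun_prop :
      Continuous fun q : (Space d × Space d) × Space d => (q.2, q.1.1)))).mul (hW.comp (by fun_prop :
      Continuous fun q : (Space d × Space d) × Space d => (q.2, q.1.2)))
  have hG : Integrable (fun q : (Space d × Space d) × Space d => f q.1 * H q)
      ((volume.prod volume).prod volume) := by
    refine integrable_mul_of_norm_le_tent hR (integrable_form hK u u) hHc.aestronglyMeasurable
      (c := Prod.fst) fun p z => ?_
    rw [hH, norm_mul, RCLike.norm_conj]
    exact (mul_le_of_le_one_right (norm_nonneg _) (hle1 _ _)).trans (hle _ _)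
  have hG2 : Integrable (fun q : Space d × Space d => ‖u q.1‖ ^ 2 * ‖W q.2 q.1‖ ^ 2)
      (volume.prod volume) := by
    refine integrable_mul_of_norm_le_tent (H := fun q => ‖W q.2 q.1‖ ^ 2) hR (integrable_norm_sq u)
      (Continuous.aestronglyMeasurable ?_) (c := id) fun p z => ?_
    · exact ((hW.comp (by fun_prop : Continuous fun q : Space d × Space d => (q.2, q.1))).norm).pow 2
    · rw [Real.norm_of_nonneg (by positivity), sq]
      exact (mul_le_of_le_one_right (norm_nonneg _) (hle1 _ _)).trans (hle _ _)
  have hmem : ∀ z, MemLp (fun x => W z x * u x) 2 volume := fun z => by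
    refine (Lp.memLp u).mono ((hWz z).aestronglyMeasurable.mul (Lp.aestronglyMeasurable u))
      (ae_of_all _ fun x => ?_)
    rw [norm_mul]
    exact mul_le_of_le_one_left (norm_nonneg _) (hle1 _ _)
  -- For fixed centre `z` the integrand is the form of `K` at the localized function `W z * u`, to
  -- which the assumed bound applies.
  have hform : ∀ z, ∫ p, f p * H (p, z) ∂(volume.prod volume)
      = inner ℂ ((hmem z).toLp) (kernelOp K (hmem z).toLp) := fun z => by
    rw [inner_kernelOp hK]
    refine integral_congr_ae ?_
    have h1 := (Measure.quasiMeasurePreserving_fst (μ := (volume : Measure (Space d)))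
      (ν := (volume : Measure (Space d)))).ae (hmem z).coeFn_toLp
    have h2 := (Measure.quasiMeasurePreserving_snd (μ := (volume : Measure (Space d)))
      (ν := (volume : Measure (Space d)))).ae (hmem z).coeFn_toLp
    filter_upwards [h1, h2] with p hp1 hp2
    rw [hp1, hp2, hf, hH]
    simp only [map_mul]
    ring
  have hnorm : ∀ z, ‖(hmem z).toLp‖ ^ 2 = ∫ x, ‖u x‖ ^ 2 * ‖W z x‖ ^ 2 := fun z => by
    rw [norm_sq_eq_integral]
    refine integral_congr_ae ?_
    filter_upwards [(hmem z).coeFn_toLp] with x hx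
    rw [hx, norm_mul]
    ring
  have hswap : ∫ p, (∫ z, f p * H (p, z)) ∂(volume.prod volume)
      = ∫ z, ∫ p, f p * H (p, z) ∂(volume.prod volume) :=
    integral_integral_swap (f := fun p z => f p * H (p, z)) hG
  have hlhs : inner ℂ u (kernelOp L u)
      = (((tentMass d R)⁻¹ : ℝ) : ℂ) * ∫ z, ∫ p, f p * H (p, z) ∂(volume.prod volume) := by
    rw [inner_kernelOp hL, ← hswap, ← integral_const_mul]
    refine integral_congr_ae (ae_of_all _ fun p => ?_)
    simp only [integral_const_mul, hLK, hf, hH]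
    push_cast
    ring
  have hint : ∫ z, (∫ p, f p * H (p, z) ∂(volume.prod volume)).re
      ≤ ∫ z, E * ∫ x, ‖u x‖ ^ 2 * ‖W z x‖ ^ 2 := by
    refine integral_mono hG.integral_prod_right.re (hG2.integral_prod_right.const_mul E) fun z => ?_
    simp only
    rw [hform, ← hnorm]
    exact hE _
  -- The localized norms add up exactly, so localization does not worsen the constant `E`.
  have hrhs : ∫ z, ∫ x, ‖u x‖ ^ 2 * ‖W z x‖ ^ 2 = tentMass d R * ‖u‖ ^ 2 := by
    rw [← integral_integral_swap (f := fun x z => ‖u x‖ ^ 2 * ‖W z x‖ ^ 2) hG2]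
    simp only [integral_const_mul, hmass]
    rw [integral_mul_const, ← norm_sq_eq_integral, mul_comm]
  rw [integral_const_mul, hrhs] at hint
  have hre : ∫ z, (∫ p, f p * H (p, z) ∂(volume.prod volume)).re
      = (∫ z, ∫ p, f p * H (p, z) ∂(volume.prod volume)).re :=
    integral_re hG.integral_prod_right
  rw [hlhs, Complex.re_ofReal_mul, ← hre, inv_mul_le_iff₀ hN]
  linarith

theorem FormBound.average {K₁ K₂ : Space d → Space d → ℂ} {E₁ E₂ : ℝ} (h₁ : FormBound K₁ E₁)
    (h₂ : FormBound K₂ E₂) (hK₁ : IsSchurKernel 0 K₁) (hK₂ : IsSchurKernel 0 K₂)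
    (hL : IsSchurKernel 0 L) (hLK : ∀ x y, L x y = (K₁ x y + K₂ x y) / 2) :
    FormBound L ((E₁ + E₂) / 2) := by
  intro u
  have e : inner ℂ u (kernelOp L u)
      = (inner ℂ u (kernelOp K₁ u) + inner ℂ u (kernelOp K₂ u)) / 2 := by
    rw [inner_kernelOp hL, inner_kernelOp hK₁, inner_kernelOp hK₂,
      ← integral_add (integrable_form hK₁ u u) (integrable_form hK₂ u u), ← integral_div]
    refine integral_congr_ae (ae_of_all _ fun p => ?_)
    simp only [hLK]
    ring
  have e2 : (inner ℂ u (kernelOp L u)).re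
      = ((inner ℂ u (kernelOp K₁ u)).re + (inner ℂ u (kernelOp K₂ u)).re) / 2 := by
    rw [e]
    simp
  rw [e2]
  linarith [h₁ u, h₂ u]

/-- Perturbation of a form bound by a kernel that is small compared to `K`. -/
theorem FormBound.perturb {α κ : ℝ} (hκ : 0 ≤ κ) (hL : IsSchurKernel 0 L) (h : FormBound L E)
    (hK : IsSchurKernel 0 K)
    {J : Space d → Space d → ℂ} (hJ : IsSchurKernel α J)
    (hle : ∀ x y, ‖K x y - L x y‖ ≤ κ * bracket (x - y) ^ α * ‖J x y‖) :
    FormBound K (E + κ * (schurNorm α J).toReal) := by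
  have hnorm : schurNorm 0 (fun x y => K x y - L x y) ≤ ENNReal.ofReal κ * schurNorm α J := by
    refine schurNorm_le_of_enorm_le (fun x y => ?_) ENNReal.ofReal_ne_top
    rw [Real.rpow_zero, ENNReal.ofReal_one, mul_one, ← ofReal_norm, ← ofReal_norm (J x y),
      ← ENNReal.ofReal_mul (norm_nonneg _), ← ENNReal.ofReal_mul hκ]
    refine ENNReal.ofReal_le_ofReal ((hle x y).trans_eq (by ring))
  have htop : ENNReal.ofReal κ * schurNorm α J ≠ ∞ :=
    (ENNReal.mul_lt_top ENNReal.ofReal_lt_top hJ.finite).ne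
  have hD : IsSchurKernel 0 (fun x y => K x y - L x y) :=
    ⟨hK.aestronglyMeasurable.sub hL.aestronglyMeasurable, hnorm.trans_lt htop.lt_top⟩
  have hop : ‖kernelOp (fun x y => K x y - L x y)‖ ≤ κ * (schurNorm α J).toReal := by
    refine (norm_kernelOp_le hD).trans ((ENNReal.toReal_mono htop hnorm).trans_eq ?_)
    rw [ENNReal.toReal_mul, ENNReal.toReal_ofReal hκ]
  intro u
  have e : inner ℂ u (kernelOp K u)
      = inner ℂ u (kernelOp L u) + inner ℂ u (kernelOp (fun x y => K x y - L x y) u) := by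
    rw [inner_kernelOp hL, inner_kernelOp hK, inner_kernelOp hD,
      ← integral_add (integrable_form hL u u) (integrable_form hD u u)]
    refine integral_congr_ae (ae_of_all _ fun p => ?_)
    ring
  have h1 : (inner ℂ u (kernelOp (fun x y => K x y - L x y) u)).re
      ≤ κ * (schurNorm α J).toReal * ‖u‖ ^ 2 := by
    refine (Complex.re_le_norm _).trans ((norm_inner_le_norm _ _).trans ?_)
    calc _ ≤ ‖u‖ * (‖kernelOp (fun x y => K x y - L x y)‖ * ‖u‖) := by
          gcongr; exact ContinuousLinearMap.le_opNorm _ _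
      _ ≤ ‖u‖ * (κ * (schurNorm α J).toReal * ‖u‖) := by gcongr
      _ = _ := by ring
  rw [e, Complex.add_re, add_mul]
  exact add_le_add (h u) h1

end Localization

/-! ### Flux estimates, cancellation, and scaling of the field -/

section Flux

variable {d : ℕ} {A : Space d → Space d}

theorem abs_apply_le_norm (v : Space d) (j : Fin d) : |v j| ≤ ‖v‖ := by
  simpa using PiLp.norm_apply_le v j

theorem abs_flux_le {B : Space d → Fin d → Fin d → ℝ} {β : ℝ} {x y z : Space d} (hβ : 0 ≤ β)
    (hB : ∀ t ∈ Icc (0 : ℝ) 1, ∀ s ∈ Icc 0 t, ∀ j k,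
      |B (x + t • (y - x) + s • (z - y)) j k| ≤ β) :
    |flux B x y z| ≤ d ^ 2 * (β * (‖y - x‖ * ‖z - y‖)) := by
  have hI : ∀ j k, |∫ t in (0 : ℝ)..1, ∫ s in (0 : ℝ)..t,
      B (x + t • (y - x) + s • (z - y)) j k| ≤ β := by
    intro j k
    have h1 : ∀ t ∈ uIoc (0 : ℝ) 1, ‖∫ s in (0 : ℝ)..t,
        B (x + t • (y - x) + s • (z - y)) j k‖ ≤ β := by
      intro t ht
      rw [uIoc_of_le zero_le_one] at ht
      refine (intervalIntegral.norm_integral_le_of_norm_le_const (C := β) fun s hs => ?_).trans ?_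
      · rw [uIoc_of_le ht.1.le] at hs
        exact hB t ⟨ht.1.le, ht.2⟩ s ⟨hs.1.le, hs.2⟩ j k
      · rw [sub_zero, abs_of_pos ht.1]
        exact mul_le_of_le_one_right hβ ht.2
    simpa using intervalIntegral.norm_integral_le_of_norm_le_const h1
  have hterm : ∀ j k, |(y j - x j) * (z k - y k) * ∫ t in (0 : ℝ)..1, ∫ s in (0 : ℝ)..t,
      B (x + t • (y - x) + s • (z - y)) j k| ≤ β * (‖y - x‖ * ‖z - y‖) := by
    intro j k
    rw [abs_mul, abs_mul, mul_comm]
    refine mul_le_mul (hI j k) ?_ (by positivity) hβ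
    exact mul_le_mul (abs_apply_le_norm (y - x) j) (abs_apply_le_norm (z - y) k) (abs_nonneg _)
      (norm_nonneg _)
  refine (Finset.abs_sum_le_sum_abs _ _).trans ?_
  refine (Finset.sum_le_sum fun j _ => (Finset.abs_sum_le_sum_abs _ _).trans
    (Finset.sum_le_sum fun k _ => hterm j k)).trans_eq ?_
  simp only [Finset.sum_const, Finset.card_univ, Fintype.card_fin, nsmul_eq_mul]
  ring

theorem flux_const_mul (c : ℝ) (B : Space d → Fin d → Fin d → ℝ) (x y z : Space d) :
    flux (fun p j k => c * B p j k) x y z = c * flux B x y z := by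
  simp only [flux, intervalIntegral.integral_const_mul, Finset.mul_sum]
  refine Finset.sum_congr rfl fun j _ => Finset.sum_congr rfl fun k _ => ?_
  ring

theorem flux_const (b : Fin d → Fin d → ℝ) (x y z : Space d) :
    flux (fun _ => b) x y z = ∑ j, ∑ k, (y j - x j) * (z k - y k) * (b j k / 2) := by
  have h : ∀ c : ℝ, ∫ t in (0 : ℝ)..1, ∫ _ in (0 : ℝ)..t, c = c / 2 := fun c => by
    simp only [intervalIntegral.integral_const, smul_eq_mul, sub_zero,
      intervalIntegral.integral_mul_const, integral_id]
    ring
  simp only [flux, h]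

/-- The second sides `z - y` and `x - z` of the two triangles add up to `x - y`, so the sum is an
antisymmetric form evaluated at two parallel vectors. -/
theorem flux_const_add_flux_const {b : Fin d → Fin d → ℝ} (hb : ∀ j k, b k j = -b j k)
    (x y z : Space d) :
    flux (fun _ => b) x y z + flux (fun _ => b) x y (x + y - z) = 0 := by
  have h : flux (fun _ => b) x y z + flux (fun _ => b) x y (x + y - z)
      = ∑ j, ∑ k, -((y j - x j) * (y k - x k) * (b j k / 2)) := by
    rw [flux_const, flux_const, ← Finset.sum_add_distrib]
    refine Finset.sum_congr rfl fun j _ => ?_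
    rw [← Finset.sum_add_distrib]
    refine Finset.sum_congr rfl fun k _ => ?_
    simp only [PiLp.sub_apply, PiLp.add_apply]
    ring
  have h2 : ∑ j, ∑ k, -((y j - x j) * (y k - x k) * (b j k / 2))
      = -∑ j, ∑ k, -((y j - x j) * (y k - x k) * (b j k / 2)) := by
    conv_lhs => rw [Finset.sum_comm]
    rw [← Finset.sum_neg_distrib]
    refine Finset.sum_congr rfl fun j _ => ?_
    rw [← Finset.sum_neg_distrib]
    refine Finset.sum_congr rfl fun k _ => ?_
    rw [hb j k]
    ring
  rw [h]
  linarith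

theorem flux_sub_const {B : Space d → Fin d → Fin d → ℝ}
    (hB : ∀ j k, Continuous fun p => B p j k) (b : Fin d → Fin d → ℝ) (x y z : Space d) :
    flux (fun p j k => B p j k - b j k) x y z = flux B x y z - flux (fun _ => b) x y z := by
  simp only [flux, ← Finset.sum_sub_distrib, ← mul_sub]
  refine Finset.sum_congr rfl fun j _ => Finset.sum_congr rfl fun k _ => ?_
  have hc : Continuous (Function.uncurry fun t s : ℝ => B (x + t • (y - x) + s • (z - y)) j k) :=
    (hB j k).comp (by fun_prop :
      Continuous fun p : ℝ × ℝ => x + p.1 • (y - x) + p.2 • (z - y))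
  rw [← intervalIntegral.integral_sub]
  · congr 1
    refine intervalIntegral.integral_congr fun t _ => ?_
    exact intervalIntegral.integral_sub
      ((hc.comp (by fun_prop : Continuous fun s : ℝ => (t, s))).intervalIntegrable _ _)
      (continuous_const.intervalIntegrable _ _)
  · exact (intervalIntegral.continuous_parametric_intervalIntegral_of_continuous hc
      continuous_id').intervalIntegrable _ _
  · exact (intervalIntegral.continuous_parametric_intervalIntegral_of_continuous
      (f := fun _ _ : ℝ => b j k) continuous_const continuous_id').intervalIntegrable _ _

theorem magneticField_swap (A : Space d → Space d) (x : Space d) (j k : Fin d) :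
    magneticField A x k j = -magneticField A x j k := by
  simp [magneticField]

/-- The fluxes through the triangles `x, y, z` and `x, y, x + y - z` nearly cancel when the field
varies slowly. -/
theorem abs_flux_add_flux_reflect_le (hA : ContDiff ℝ 1 A) {Λ : ℝ} (hΛ : 0 ≤ Λ)
    (hlip : ∀ p q j k, |magneticField A p j k - magneticField A q j k| ≤ Λ * ‖p - q‖)
    {R : ℝ} {x y z : Space d} (hx : ‖x - z‖ < R) (hy : ‖y - z‖ < R) :
    |flux (magneticField A) x y z + flux (magneticField A) x y (x + y - z)|
      ≤ 6 * d ^ 2 * Λ * ‖x - y‖ * R ^ 2 := by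
  have hR : 0 < R := (norm_nonneg _).trans_lt hx
  have hxy : ‖y - x‖ ≤ 2 * R := by
    have : y - x = (y - z) - (x - z) := by abel
    rw [this]
    linarith [norm_sub_le (y - z) (x - z)]
  set b := magneticField A y with hb
  -- The field is frozen at its value at `y`. Points of the triangle are within `3R` of `y`, namely
  -- `2R` from the side `x, y` and `R` from the side `y, w`.
  have hD : ∀ w : Space d, ‖w - y‖ ≤ R →
      |flux (magneticField A) x y w - flux (fun _ => b) x y w|
        ≤ d ^ 2 * (Λ * (3 * R) * (‖y - x‖ * R)) := by
    intro w hw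
    rw [← flux_sub_const (continuous_magneticField hA)]
    refine (abs_flux_le (β := Λ * (3 * R)) (by positivity) fun t ht s hs j k => ?_).trans ?_
    · refine (hlip _ _ j k).trans (mul_le_mul_of_nonneg_left ?_ hΛ)
      have e : x + t • (y - x) + s • (w - y) - y = (t - 1) • (y - x) + s • (w - y) := by module
      rw [e]
      refine (norm_add_le _ _).trans ?_
      rw [norm_smul, norm_smul, Real.norm_eq_abs, Real.norm_eq_abs]
      have h1 : |t - 1| ≤ 1 := abs_le.2 ⟨by linarith [ht.1], by linarith [ht.2]⟩
      have h2 : |s| ≤ 1 := abs_le.2 ⟨by linarith [hs.1], hs.2.trans ht.2⟩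
      have h3 := mul_le_mul h1 hxy (norm_nonneg _) zero_le_one
      have h4 := mul_le_mul h2 hw (norm_nonneg _) zero_le_one
      linarith
    · gcongr
  have h1 := hD z (by rw [norm_sub_rev]; exact hy.le)
  have h2 := hD (x + y - z) (by
    have : x + y - z - y = x - z := by abel
    rw [this]; exact hx.le)
  have h3 := flux_const_add_flux_const (b := b) (fun j k => magneticField_swap A y j k) x y z
  rw [norm_sub_rev] at h1 h2
  have e : flux (magneticField A) x y z + flux (magneticField A) x y (x + y - z)
      = (flux (magneticField A) x y z - flux (fun _ => b) x y z)
        + (flux (magneticField A) x y (x + y - z) - flux (fun _ => b) x y (x + y - z)) := by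
    linarith
  rw [e]
  refine (abs_add_le _ _).trans ((add_le_add h1 h2).trans_eq ?_)
  ring

theorem continuous_flux (hA : ContDiff ℝ 1 A) (x y : Space d) :
    Continuous fun z => flux (magneticField A) x y z := by
  have h := continuous_phase hA
  have e : (fun z => flux (magneticField A) x y z) = fun z =>
      Function.uncurry (phase A) (x, z) + Function.uncurry (phase A) (z, y) - phase A x y := by
    ext z
    simp only [Function.uncurry_apply_pair]
    rw [phase_add_phase hA]
    ring
  rw [e]
  fun_prop

theorem continuous_exp_I_mul {X : Type*} [TopologicalSpace X] {f : X → ℝ} (hf : Continuous f) :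
    Continuous fun z => Complex.exp (Complex.I * (f z : ℂ)) :=
  Complex.continuous_exp.comp (continuous_const.mul (Complex.continuous_ofReal.comp hf))

theorem norm_exp_I_mul (a : ℝ) : ‖Complex.exp (Complex.I * a)‖ = 1 := by
  rw [mul_comm, Complex.norm_exp_ofReal_mul_I]

theorem norm_twist (φ : Space d → Space d → ℝ) (K : Space d → Space d → ℂ) (x y : Space d) :
    ‖twist φ K x y‖ = ‖K x y‖ := by
  rw [twist, norm_mul, norm_exp_I_mul, one_mul]

/-- The average phase factor over triangles with vertices `x`, `y`. -/
def avgPhase (A : Space d → Space d) (R : ℝ) (x y : Space d) : ℂ :=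
  locAvg R x y fun z => Complex.exp (Complex.I * (flux (magneticField A) x y z : ℂ))

theorem norm_avgPhase_le_one {R : ℝ} (hR : 0 < R) (x y : Space d) : ‖avgPhase A R x y‖ ≤ 1 :=
  norm_locAvg_le hR x y zero_le_one fun _ _ _ => (norm_exp_I_mul _).le

/-- Common source of both cancellations: `F` and `G` will be the fluxes through a triangle and its
reflection, or the fluxes of two opposite fields through the same triangle. -/
theorem norm_locAvg_average_exp_sub_one_le {R : ℝ} (hR : 0 < R) (x y : Space d)
    {F G : Space d → ℝ} (hF : Continuous F) (hG : Continuous G) {b δ : ℝ} (hδ : 0 ≤ δ)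
    (hFb : ∀ z, ‖x - z‖ < R → ‖y - z‖ < R → |F z| ≤ b)
    (hGb : ∀ z, ‖x - z‖ < R → ‖y - z‖ < R → |G z| ≤ b)
    (hFG : ∀ z, ‖x - z‖ < R → ‖y - z‖ < R → |F z + G z| ≤ δ) :
    ‖(locAvg R x y (fun z => Complex.exp (Complex.I * (F z : ℂ)))
      + locAvg R x y (fun z => Complex.exp (Complex.I * (G z : ℂ)))) / 2 - 1‖
      ≤ 2 ^ (d + 2) * (‖x - y‖ / R) ^ 2 + (δ / 2 + 3 * b ^ 2) := by
  rw [← locAvg_average hR x y (continuous_exp_I_mul hF) (continuous_exp_I_mul hG)]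
  refine norm_locAvg_sub_one_le hR x y
    (((continuous_exp_I_mul hF).add (continuous_exp_I_mul hG)).div_const 2) (by positivity)
    fun z hx hy => (norm_average_exp_sub_one_le _ _).trans ?_
  have h1 := sq_le_sq' (abs_le.1 (hFb z hx hy)).1 (abs_le.1 (hFb z hx hy)).2
  have h2 := sq_le_sq' (abs_le.1 (hGb z hx hy)).1 (abs_le.1 (hGb z hx hy)).2
  linarith [hFG z hx hy]

theorem abs_flux_magneticField_le {β : ℝ} (hβ : 0 ≤ β) (hb : ∀ p j k, |magneticField A p j k| ≤ β)
    {R : ℝ} {x y z : Space d} (hy : ‖z - y‖ ≤ R) :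
    |flux (magneticField A) x y z| ≤ d ^ 2 * β * ‖x - y‖ * R := by
  refine (abs_flux_le hβ fun t _ s _ j k => hb _ j k).trans ?_
  rw [norm_sub_rev y x]
  calc (d : ℝ) ^ 2 * (β * (‖x - y‖ * ‖z - y‖)) ≤ d ^ 2 * (β * (‖x - y‖ * R)) := by gcongr
    _ = _ := by ring

/-- By reflection invariance of the weights, the averages of the phase factors of the flux and of
the reflected flux coincide; hence the mean of the two is `avgPhase` itself. -/
theorem norm_avgPhase_sub_one_le (hA : ContDiff ℝ 1 A) {β Λ : ℝ} (hβ : 0 ≤ β)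
    (hb : ∀ p j k, |magneticField A p j k| ≤ β) (hΛ : 0 ≤ Λ)
    (hlip : ∀ p q j k, |magneticField A p j k - magneticField A q j k| ≤ Λ * ‖p - q‖)
    {R : ℝ} (hR : 0 < R) (x y : Space d) :
    ‖avgPhase A R x y - 1‖ ≤ 2 ^ (d + 2) * (‖x - y‖ / R) ^ 2
      + (6 * d ^ 2 * Λ * ‖x - y‖ * R ^ 2 / 2 + 3 * (d ^ 2 * β * ‖x - y‖ * R) ^ 2) := by
  have hF := continuous_flux hA x y
  have h := norm_locAvg_average_exp_sub_one_le hR x y hF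
    (hF.comp (by fun_prop : Continuous fun z : Space d => x + y - z))
    (b := d ^ 2 * β * ‖x - y‖ * R) (δ := 6 * d ^ 2 * Λ * ‖x - y‖ * R ^ 2) (by positivity)
    (fun z _ hy => abs_flux_magneticField_le hβ hb (by rw [norm_sub_rev]; exact hy.le))
    (fun z hx _ => abs_flux_magneticField_le hβ hb (by
      have : x + y - z - y = x - z := by abel
      rw [this]; exact hx.le))
    (fun z hx hy => abs_flux_add_flux_reflect_le hA hΛ hlip hx hy)
  have e : locAvg R x y (fun z => Complex.exp (Complex.I *
      (((fun z => flux (magneticField A) x y z) ∘ fun z => x + y - z) z : ℂ))) = avgPhase A R x y :=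
    locAvg_reflect x y fun z => Complex.exp (Complex.I * (flux (magneticField A) x y z : ℂ))
  rw [e] at h
  rwa [avgPhase, add_self_div_two] at h

theorem magneticField_smul (hA : ContDiff ℝ 1 A) (s : ℝ) (x : Space d) (j k : Fin d) :
    magneticField (fun x => s • A x) x j k = s * magneticField A x j k := by
  have h : fderiv ℝ (fun x => s • A x) x = s • fderiv ℝ A x :=
    fderiv_const_smul (hA.differentiable one_ne_zero x) s
  simp only [magneticField, h]
  simp [mul_sub]

theorem phase_smul (hA : ContDiff ℝ 1 A) (s : ℝ) (x y : Space d) :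
    phase (fun x => s • A x) x y = s * phase A x y := by
  have h : magneticField (fun x => s • A x) = fun p j k => s * magneticField A p j k := by
    ext p j k; exact magneticField_smul hA s p j k
  rw [phase, phase, h, flux_const_mul]
  ring

theorem magneticField_comp_smul (hA : ContDiff ℝ 1 A) (s : ℝ) (x : Space d) (j k : Fin d) :
    magneticField (fun x => A (s • x)) x j k = s * magneticField A (s • x) j k := by
  have h : HasFDerivAt (fun x => A (s • x))
      ((fderiv ℝ A (s • x)).comp (s • ContinuousLinearMap.id ℝ (Space d))) x :=
    (hA.differentiable one_ne_zero (s • x)).hasFDerivAt.comp x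
      ((hasFDerivAt_id x).const_smul s)
  simp only [magneticField, h.fderiv]
  simp [mul_sub]

/-- The slowly varying phase is the ordinary phase of a rescaled potential, so results stated for
one potential cover it. -/
theorem phase_comp_smul (hA : ContDiff ℝ 1 A) (s : ℝ) (x y : Space d) :
    phase (fun x => A (s • x)) x y = slowPhase A s x y := by
  have h : magneticField (fun x => A (s • x)) = fun p j k => s * magneticField A (s • p) j k := by
    ext p j k; exact magneticField_comp_smul hA s p j k
  rw [phase, slowPhase, h, flux_const_mul s fun p => magneticField A (s • p)]
  ring

theorem HasBoundedFieldDeriv.abs_sub_le {M : ℝ} (h : HasBoundedFieldDeriv M A) (p q : Space d)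
    (j k : Fin d) :
    |magneticField A p j k - magneticField A q j k| ≤ d * |M| * ‖p - q‖ := by
  refine Convex.norm_image_sub_le_of_norm_fderiv_le (𝕜 := ℝ) (s := univ)
    (f := fun x => magneticField A x j k) (fun x _ => h.differentiable j k x) (fun x _ => ?_)
    convex_univ (mem_univ q) (mem_univ p)
  refine ContinuousLinearMap.opNorm_le_bound _ (by positivity) fun w => ?_
  conv_lhs => rw [← (EuclideanSpace.basisFun (Fin d) ℝ).sum_repr w]
  rw [map_sum]
  refine (norm_sum_le _ _).trans ?_
  have : ∀ l ∈ Finset.univ, ‖fderiv ℝ (fun x => magneticField A x j k) x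
      ((EuclideanSpace.basisFun (Fin d) ℝ).repr w l • EuclideanSpace.basisFun (Fin d) ℝ l)‖
      ≤ |M| * ‖w‖ := fun l _ => by
    rw [map_smul, norm_smul, mul_comm]
    refine mul_le_mul ?_ (by simpa using abs_apply_le_norm w l) (norm_nonneg _) (abs_nonneg _)
    rw [EuclideanSpace.basisFun_apply]
    exact (h.bound x j k l).trans (le_abs_self M)
  refine (Finset.sum_le_sum this).trans_eq ?_
  simp [mul_assoc]

end Flux

/-! ### Comparison of edges of twisted operators -/

section Edges

variable {d : ℕ} {A : Space d → Space d} {K : Space d → Space d → ℂ} {R E : ℝ}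

theorem stronglyMeasurable_integral_conj_mul {W : Space d → Space d → ℂ}
    (hW : Continuous (Function.uncurry W)) :
    StronglyMeasurable fun p : Space d × Space d => ∫ z, conj (W z p.1) * W z p.2 := by
  have h1 : Continuous fun q : (Space d × Space d) × Space d => W q.2 q.1.1 :=
    hW.comp (by fun_prop : Continuous fun q : (Space d × Space d) × Space d => (q.2, q.1.1))
  have h2 : Continuous fun q : (Space d × Space d) × Space d => W q.2 q.1.2 :=
    hW.comp (by fun_prop : Continuous fun q : (Space d × Space d) × Space d => (q.2, q.1.2))
  have h3 : Continuous fun q : (Space d × Space d) × Space d => conj (W q.2 q.1.1) * W q.2 q.1.2 :=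
    (RCLike.continuous_conj.comp h1).mul h2
  exact h3.stronglyMeasurable.integral_prod_right'

/-- Averaging over localizations in the gauges based at their centers. -/
theorem FormBound.avgPhase_mul_twist (hA : ContDiff ℝ 1 A) (hK : IsSchurKernel 0 K)
    (hE : FormBound K E) (hR : 0 < R) :
    IsSchurKernel 0 (fun x y => avgPhase A R x y * twist (phase A) K x y) ∧
      FormBound (fun x y => avgPhase A R x y * twist (phase A) K x y) E := by
  set W : Space d → Space d → ℂ := fun z x =>
    Complex.exp (Complex.I * (phase A z x : ℂ)) * (tent R (x - z) : ℂ) with hW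
  have hc : Continuous (Function.uncurry W) :=
    (continuous_exp_I_mul (continuous_phase hA)).mul (Complex.continuous_ofReal.comp
      (continuous_tent.comp (by fun_prop : Continuous fun p : Space d × Space d => p.2 - p.1)))
  have hnorm : ∀ z x, ‖W z x‖ = tent R (x - z) := fun z x => by
    rw [hW, norm_mul, norm_exp_I_mul, one_mul, Complex.norm_real,
      Real.norm_of_nonneg (tent_nonneg _)]
  -- By the cocycle identity the two gauge factors based at `z` combine into the phase from `x` to
  -- `y`, independent of `z`, and a flux factor.
  have hprod : ∀ x y z, conj (W z x) * W z y = Complex.exp (Complex.I * (phase A x y : ℂ)) *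
      (((tent R (x - z) * tent R (y - z) : ℝ) : ℂ) *
        Complex.exp (Complex.I * (flux (magneticField A) x y z : ℂ))) := fun x y z => by
    have h1 := phase_add_phase hA x y z
    have h2 : (flux (magneticField A) x y z : ℂ)
        = -(phase A z x : ℂ) + phase A z y - phase A x y := by
      rw [phase_swap hA z x] at h1
      have : flux (magneticField A) x y z = -phase A z x + phase A z y - phase A x y := by linarith
      rw [this]; push_cast; ring
    have h3 : Complex.exp (Complex.I * (flux (magneticField A) x y z : ℂ))
        = Complex.exp (-(Complex.I * (phase A z x : ℂ))) * Complex.exp (Complex.I * (phase A z y : ℂ))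
          * Complex.exp (-(Complex.I * (phase A x y : ℂ))) := by
      rw [← Complex.exp_add, ← Complex.exp_add, h2]
      congr 1; ring
    have h4 : Complex.exp (Complex.I * (phase A x y : ℂ))
        * Complex.exp (-(Complex.I * (phase A x y : ℂ))) = 1 := by
      rw [← Complex.exp_add, add_neg_cancel, Complex.exp_zero]
    have h5 : conj (Complex.exp (Complex.I * (phase A z x : ℂ)))
        = Complex.exp (-(Complex.I * (phase A z x : ℂ))) := by
      rw [← Complex.exp_conj]; simp
    simp only [hW, map_mul, Complex.conj_ofReal, h5, h3, Complex.ofReal_mul]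
    linear_combination (-(Complex.exp (-(Complex.I * (phase A z x : ℂ))) *
      Complex.exp (Complex.I * (phase A z y : ℂ)) * tent R (x - z) * tent R (y - z))) * h4
  have hL : ∀ x y, avgPhase A R x y * twist (phase A) K x y
      = (tentMass d R : ℂ)⁻¹ * (∫ z, conj (W z x) * W z y) * K x y := fun x y => by
    simp only [hprod]
    rw [integral_const_mul, avgPhase, locAvg, twist]
    ring
  have hmeas := stronglyMeasurable_integral_conj_mul hc
  have hS : IsSchurKernel 0 (fun x y => avgPhase A R x y * twist (phase A) K x y) := by
    refine ⟨?_, ?_⟩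
    · refine (((hmeas.aestronglyMeasurable.const_mul _).mul hK.aestronglyMeasurable)).congr
        (ae_of_all _ fun p => (hL p.1 p.2).symm)
    · refine (schurNorm_le_of_enorm_le (κ := 1) (K := K) (α := 0) (fun x y => ?_)
        ENNReal.one_ne_top).trans_lt (by rw [one_mul]; exact hK.finite)
      rw [one_mul]
      gcongr
      rw [← ofReal_norm, ← ofReal_norm, norm_mul, norm_twist]
      exact ENNReal.ofReal_le_ofReal
        (mul_le_of_le_one_left (norm_nonneg _) (norm_avgPhase_le_one hR x y))
  refine ⟨hS, hE.localize hK hR hc (fun z x => (hnorm z x).le) (fun x => ?_) hS hL⟩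
  simp only [hnorm]
  exact integral_tent_sub_sq x

/-- One-sided comparison of form bounds when the average phase factor is close to `1`. -/
theorem FormBound.twist_phase {α κ : ℝ} (hA : ContDiff ℝ 1 A) (hα : 0 ≤ α)
    (hK : IsSchurKernel α K) (hE : FormBound K E) (hR : 0 < R) (hκ : 0 ≤ κ)
    (hm : ∀ x y : Space d, ‖avgPhase A R x y - 1‖ ≤ κ * bracket (x - y) ^ α) :
    FormBound (twist (phase A) K) (E + κ * (schurNorm α K).toReal) := by
  have hK0 := hK.mono hα
  obtain ⟨hS, hb⟩ := hE.avgPhase_mul_twist hA hK0 hR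
  refine hb.perturb hκ hS (hK0.twist (continuous_phase hA)) hK fun x y => ?_
  have e : twist (phase A) K x y - avgPhase A R x y * twist (phase A) K x y
      = -((avgPhase A R x y - 1) * twist (phase A) K x y) := by ring
  rw [e, norm_neg, norm_mul, norm_twist]
  exact mul_le_mul_of_nonneg_right (hm x y) (norm_nonneg _)

/-- Comparison of `K` with its twists by opposite phases. -/
theorem FormBound.of_twist_phase {α κ E₁ E₂ : ℝ} (hA : ContDiff ℝ 1 A) (hα : 0 ≤ α)
    (hK : IsSchurKernel α K) (h₁ : FormBound (twist (phase A) K) E₁)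
    (h₂ : FormBound (twist (phase fun x => (-1 : ℝ) • A x) K) E₂) (hR : 0 < R) (hκ : 0 ≤ κ)
    (hm : ∀ x y : Space d, ‖(avgPhase (fun x => (-1 : ℝ) • A x) R x y + avgPhase A R x y) / 2 - 1‖
      ≤ κ * bracket (x - y) ^ α) :
    FormBound K ((E₁ + E₂) / 2 + κ * (schurNorm α K).toReal) := by
  have hK0 := hK.mono hα
  have hA' : ContDiff ℝ 1 fun x => (-1 : ℝ) • A x := hA.const_smul (-1 : ℝ)
  have hinv : ∀ x y, phase (fun x => (-1 : ℝ) • A x) x y = -phase A x y := fun x y => by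
    rw [phase_smul hA]; ring
  obtain ⟨hS₁, hb₁⟩ := h₁.avgPhase_mul_twist hA' (hK0.twist (continuous_phase hA)) hR
  obtain ⟨hS₂, hb₂⟩ := h₂.avgPhase_mul_twist hA (hK0.twist (continuous_phase hA')) hR
  -- Twisting each hypothesis back by the opposite phase makes both localized kernels multiples of
  -- the same `K`, so that their forms can be averaged.
  have e₁ : twist (phase fun x => (-1 : ℝ) • A x) (twist (phase A) K) = K := by
    rw [twist_twist]
    simp only [hinv, neg_add_cancel]
    exact twist_zero
  have e₂ : twist (phase A) (twist (phase fun x => (-1 : ℝ) • A x) K) = K := by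
    rw [twist_twist]
    simp only [hinv, add_neg_cancel]
    exact twist_zero
  rw [e₁] at hS₁ hb₁
  rw [e₂] at hS₂ hb₂
  have hSL : IsSchurKernel 0 (fun x y =>
      (avgPhase (fun x => (-1 : ℝ) • A x) R x y * K x y + avgPhase A R x y * K x y) / 2) := by
    refine ⟨?_, ?_⟩
    · have h := (hS₁.aestronglyMeasurable.add hS₂.aestronglyMeasurable).mul_const (2 : ℂ)⁻¹
      exact h
    · refine (schurNorm_le_of_enorm_le (κ := 1) (K := K) (α := 0) (fun x y => ?_)
        ENNReal.one_ne_top).trans_lt (by rw [one_mul]; exact hK0.finite)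
      rw [one_mul]
      gcongr
      rw [← ofReal_norm, ← ofReal_norm, ← add_mul, norm_div, norm_mul, Complex.norm_ofNat]
      refine ENNReal.ofReal_le_ofReal ?_
      have h := norm_add_le (avgPhase (fun x => (-1 : ℝ) • A x) R x y) (avgPhase A R x y)
      have h3 : ‖avgPhase (fun x => (-1 : ℝ) • A x) R x y + avgPhase A R x y‖ ≤ 2 := by
        linarith [norm_avgPhase_le_one (A := A) hR x y,
          norm_avgPhase_le_one (A := fun x => (-1 : ℝ) • A x) hR x y]
      rw [div_le_iff₀ two_pos, mul_comm]
      exact mul_le_mul_of_nonneg_left h3 (norm_nonneg _)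
  refine (hb₁.average hb₂ hS₁ hS₂ hSL fun x y => rfl).perturb hκ hSL hK0 hK fun x y => ?_
  have e : K x y - (avgPhase (fun x => (-1 : ℝ) • A x) R x y * K x y + avgPhase A R x y * K x y) / 2
      = -(((avgPhase (fun x => (-1 : ℝ) • A x) R x y + avgPhase A R x y) / 2 - 1) * K x y) := by ring
  rw [e, norm_neg, norm_mul]
  exact mul_le_mul_of_nonneg_right (hm x y) (norm_nonneg _)

variable {c : ℂ}

theorem isSelfAdjoint_twist_phase (hA : ContDiff ℝ 1 A) (hK : IsSchurKernel 0 K)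
    (hsa : IsSelfAdjoint (decayOp c K)) : IsSelfAdjoint (decayOp c (twist (phase A) K)) :=
  isSelfAdjoint_decayOp_twist hK hsa (continuous_phase hA) (phase_swap hA)

theorem formBound_upperEdge (hsa : IsSelfAdjoint (decayOp c K)) :
    FormBound K (upperEdge (decayOp c K) - c.re) :=
  (upperEdge_decayOp_le_iff hsa).1 le_rfl

/-- The Lipschitz estimate for the edge with a slowly varying field of size `h`. -/
theorem abs_upperEdge_twist_phase_sub_le (hA : ContDiff ℝ 1 A) {α M Λ h : ℝ} (hα : 2 ≤ α)
    (hK : IsSchurKernel α K) (hsa : IsSelfAdjoint (decayOp c K)) (hM : 0 ≤ M) (hh : 0 < h)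
    (hb : ∀ p j k, |magneticField A p j k| ≤ M * h) (hΛ : 0 ≤ Λ)
    (hlip : ∀ p q j k, |magneticField A p j k - magneticField A q j k| ≤ Λ * h ^ 2 * ‖p - q‖) :
    |upperEdge (decayOp c (twist (phase A) K)) - upperEdge (decayOp c K)|
      ≤ (2 ^ (d + 2) + 3 * d ^ 2 * Λ + 3 * d ^ 4 * M ^ 2) * (schurNorm 2 K).toReal * h := by
  set C : ℝ := 2 ^ (d + 2) + 3 * d ^ 2 * Λ + 3 * d ^ 4 * M ^ 2 with hC
  -- The one-sided bound is stated for all potentials and kernels because the reverse inequality is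
  -- the same bound for `-A` and the twisted kernel.
  have key : ∀ A : Space d → Space d, ContDiff ℝ 1 A →
      (∀ p j k, |magneticField A p j k| ≤ M * h) →
      (∀ p q j k, |magneticField A p j k - magneticField A q j k| ≤ Λ * h ^ 2 * ‖p - q‖) →
      ∀ K : Space d → Space d → ℂ, IsSchurKernel 2 K → IsSelfAdjoint (decayOp c K) →
      upperEdge (decayOp c (twist (phase A) K))
        ≤ upperEdge (decayOp c K) + C * h * (schurNorm 2 K).toReal := by
    intro A hA hb hlip K hK hsa
    -- The radius `h^{-1/2}` balances the localization error `|x-y|²/R²` against the squared flux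
    -- `(h |x-y| R)²`: both become `h |x-y|²`. The variation term `h² |x-y| R²` becomes `h |x-y|`.
    have hR : 0 < (√h)⁻¹ := inv_pos.2 (Real.sqrt_pos.2 hh)
    have hR2 : ((√h)⁻¹) ^ 2 = h⁻¹ := by rw [inv_pow, Real.sq_sqrt hh.le]
    rw [upperEdge_decayOp_le_iff (isSelfAdjoint_twist_phase hA (hK.mono zero_le_two) hsa),
      add_sub_right_comm]
    refine (formBound_upperEdge hsa).twist_phase hA zero_le_two hK hR (by positivity) fun x y => ?_
    refine (norm_avgPhase_sub_one_le hA (by positivity) hb (by positivity) hlip hR x y).trans ?_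
    have h1 := norm_le_bracket (x - y)
    have h2 := one_le_bracket (x - y)
    have h3 : ‖x - y‖ ≤ bracket (x - y) ^ 2 := by nlinarith
    have h4 : ‖x - y‖ ^ 2 ≤ bracket (x - y) ^ 2 := by gcongr
    rw [div_pow, mul_pow _ (√h)⁻¹, hR2, Real.rpow_two]
    calc 2 ^ (d + 2) * (‖x - y‖ ^ 2 / h⁻¹) + (6 * d ^ 2 * (Λ * h ^ 2) * ‖x - y‖ * h⁻¹ / 2
          + 3 * ((d ^ 2 * (M * h) * ‖x - y‖) ^ 2 * h⁻¹))
        = 2 ^ (d + 2) * h * ‖x - y‖ ^ 2 + 3 * d ^ 2 * Λ * h * ‖x - y‖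
          + 3 * d ^ 4 * M ^ 2 * h * ‖x - y‖ ^ 2 := by field_simp; ring
      _ ≤ 2 ^ (d + 2) * h * bracket (x - y) ^ 2 + 3 * d ^ 2 * Λ * h * bracket (x - y) ^ 2
          + 3 * d ^ 4 * M ^ 2 * h * bracket (x - y) ^ 2 := by gcongr
      _ = _ := by rw [hC]; ring
  have hK2 := hK.mono hα
  have hA' : ContDiff ℝ 1 fun x => (-1 : ℝ) • A x := hA.const_smul (-1 : ℝ)
  have h1 := key A hA hb hlip K hK2 hsa
  have h2 := key (fun x => (-1 : ℝ) • A x) hA'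
    (fun p j k => by rw [magneticField_smul hA, neg_one_mul, abs_neg]; exact hb p j k)
    (fun p q j k => by
      rw [magneticField_smul hA, magneticField_smul hA, ← mul_sub, neg_one_mul, abs_neg]
      exact hlip p q j k)
    (twist (phase A) K) (hK2.twist (continuous_phase hA))
    (isSelfAdjoint_twist_phase hA (hK2.mono zero_le_two) hsa)
  have e : twist (phase fun x => (-1 : ℝ) • A x) (twist (phase A) K) = K := by
    rw [twist_twist]
    simp only [phase_smul hA, neg_one_mul, neg_add_cancel]
    exact twist_zero
  rw [e, schurNorm_twist] at h2
  rw [abs_le]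
  constructor <;> linarith

/-- Interpolates between a trivial and a quadratic bound, so that fewer than two moments of the
kernel suffice. -/
theorem min_one_le_rpow {t θ : ℝ} (ht : 0 ≤ t) (hθ : 0 ≤ θ) (hθ1 : θ ≤ 1) : min 1 t ≤ t ^ θ := by
  rcases le_or_gt t 1 with h | h
  · rcases ht.eq_or_lt with rfl | h0
    · rw [min_eq_right zero_le_one]; exact Real.rpow_nonneg le_rfl _
    · rw [min_eq_right h]
      simpa using Real.rpow_le_rpow_of_exponent_ge h0 h hθ1
  · rw [min_eq_left h.le]
    exact Real.one_le_rpow h.le hθ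

/-- Approximate midpoint convexity of the edge in the strength of the field. -/
theorem upperEdge_le_midpoint (hA : ContDiff ℝ 1 A) {α M h : ℝ} (hα : 0 ≤ α) (hα2 : α ≤ 2)
    (hK : IsSchurKernel α K) (hsa : IsSelfAdjoint (decayOp c K)) (hM : 0 ≤ M) (hh : 0 < h)
    (hb : ∀ p j k, |magneticField A p j k| ≤ M * h) :
    upperEdge (decayOp c K) ≤ (upperEdge (decayOp c (twist (phase A) K))
        + upperEdge (decayOp c (twist (phase fun x => (-1 : ℝ) • A x) K))) / 2
      + (2 + (2 ^ (d + 2) + 3 * d ^ 4 * M ^ 2)) * h ^ (α / 2) * (schurNorm α K).toReal := by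
  set C : ℝ := 2 ^ (d + 2) + 3 * d ^ 4 * M ^ 2 with hC
  have hC0 : 0 ≤ C := by positivity
  have hR : 0 < (√h)⁻¹ := inv_pos.2 (Real.sqrt_pos.2 hh)
  have hR2 : ((√h)⁻¹) ^ 2 = h⁻¹ := by rw [inv_pow, Real.sq_sqrt hh.le]
  have hK0 := hK.mono hα
  have hA' : ContDiff ℝ 1 fun x => (-1 : ℝ) • A x := hA.const_smul (-1 : ℝ)
  have h₁ := formBound_upperEdge (isSelfAdjoint_twist_phase hA hK0 hsa)
  have h₂ := formBound_upperEdge (isSelfAdjoint_twist_phase hA' hK0 hsa)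
  rw [upperEdge_decayOp_le_iff hsa]
  have hm : ∀ x y : Space d,
      ‖(avgPhase (fun x => (-1 : ℝ) • A x) (√h)⁻¹ x y + avgPhase A (√h)⁻¹ x y) / 2 - 1‖
        ≤ (2 + C) * h ^ (α / 2) * bracket (x - y) ^ α := by
    intro x y
    have hneg : ∀ z, flux (magneticField fun x => (-1 : ℝ) • A x) x y z
        = -flux (magneticField A) x y z := fun z => by
      have h : magneticField (fun x => (-1 : ℝ) • A x)
          = fun p j k => (-1 : ℝ) * magneticField A p j k := by
        ext p j k; exact magneticField_smul hA _ p j k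
      rw [h, flux_const_mul, neg_one_mul]
    have hF : ∀ z, ‖x - z‖ < (√h)⁻¹ → ‖y - z‖ < (√h)⁻¹ → |flux (magneticField A) x y z|
        ≤ d ^ 2 * (M * h) * ‖x - y‖ * (√h)⁻¹ := fun z _ hy =>
      abs_flux_magneticField_le (by positivity) hb (by rw [norm_sub_rev]; exact hy.le)
    -- Opposite potentials have exactly opposite fluxes, so `δ = 0` and no regularity of the field
    -- is needed.
    have hbd1 := norm_locAvg_average_exp_sub_one_le hR x y (continuous_flux hA' x y)
      (continuous_flux hA x y) (b := d ^ 2 * (M * h) * ‖x - y‖ * (√h)⁻¹) le_rfl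
      (fun z hx hy => by rw [hneg, abs_neg]; exact hF z hx hy) hF
      (fun z _ _ => by rw [hneg, neg_add_cancel, abs_zero])
    have hbd2 : ‖(avgPhase (fun x => (-1 : ℝ) • A x) (√h)⁻¹ x y + avgPhase A (√h)⁻¹ x y) / 2 - 1‖
        ≤ 2 := by
      refine (norm_sub_le _ _).trans ?_
      rw [norm_div, norm_one, Complex.norm_ofNat]
      have h := norm_add_le (avgPhase (fun x => (-1 : ℝ) • A x) (√h)⁻¹ x y) (avgPhase A (√h)⁻¹ x y)
      linarith [norm_avgPhase_le_one (A := A) hR x y,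
        norm_avgPhase_le_one (A := fun x => (-1 : ℝ) • A x) hR x y]
    have hbd1' : ‖(avgPhase (fun x => (-1 : ℝ) • A x) (√h)⁻¹ x y + avgPhase A (√h)⁻¹ x y) / 2 - 1‖
        ≤ C * (h * ‖x - y‖ ^ 2) := by
      refine hbd1.trans_eq ?_
      rw [div_pow, mul_pow _ (√h)⁻¹, hR2, hC]
      field_simp
      ring
    have ht : 0 ≤ h * ‖x - y‖ ^ 2 := by positivity
    -- The sum `2 + C` merely dominates both the trivial constant `2` and the quadratic constant
    -- `C`.
    have hmin : ‖(avgPhase (fun x => (-1 : ℝ) • A x) (√h)⁻¹ x y + avgPhase A (√h)⁻¹ x y) / 2 - 1‖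
        ≤ (2 + C) * min 1 (h * ‖x - y‖ ^ 2) := by
      rcases le_total 1 (h * ‖x - y‖ ^ 2) with h1 | h1
      · rw [min_eq_left h1]; linarith
      · rw [min_eq_right h1]; nlinarith
    have hpow : (h * ‖x - y‖ ^ 2) ^ (α / 2) = h ^ (α / 2) * ‖x - y‖ ^ α := by
      rw [Real.mul_rpow hh.le (by positivity), ← Real.rpow_two, ← Real.rpow_mul (norm_nonneg _)]
      congr 2
      ring
    have h5 := min_one_le_rpow ht (by linarith : 0 ≤ α / 2) (by linarith)
    rw [hpow] at h5
    refine hmin.trans ?_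
    rw [mul_assoc]
    refine mul_le_mul_of_nonneg_left (h5.trans ?_) (by positivity)
    exact mul_le_mul_of_nonneg_left
      (Real.rpow_le_rpow (norm_nonneg _) (norm_le_bracket _) hα) (by positivity)
  have := FormBound.of_twist_phase hA hα hK h₁ h₂ hR (by positivity) hm
  intro u
  refine (this u).trans_eq ?_
  ring

/-- Twisting moves the edge by at most twice the Schur norm. -/
theorem upperEdge_twist_le {α : ℝ} (hα : 0 ≤ α) (hK : IsSchurKernel α K) {φ ψ : Space d → Space d → ℝ}
    (hφ : Continuous (Function.uncurry φ)) (hψ : Continuous (Function.uncurry ψ))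
    (hsφ : IsSelfAdjoint (decayOp c (twist φ K))) (hsψ : IsSelfAdjoint (decayOp c (twist ψ K))) :
    upperEdge (decayOp c (twist φ K))
      ≤ upperEdge (decayOp c (twist ψ K)) + 2 * (schurNorm α K).toReal := by
  have hK0 := hK.mono hα
  rw [upperEdge_decayOp_le_iff hsφ, add_sub_right_comm]
  refine (formBound_upperEdge hsψ).perturb zero_le_two (hK0.twist hψ) (hK0.twist hφ) hK fun x y => ?_
  refine (norm_sub_le _ _).trans ?_
  rw [norm_twist, norm_twist]
  have := Real.one_le_rpow (one_le_bracket (x - y)) hα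
  nlinarith [norm_nonneg (K x y)]

end Edges

/-! ### Modulus of continuity from approximate midpoint convexity -/

section MidpointConvexity

variable {f : ℝ → ℝ} {P Q θ : ℝ}

/-- With `s = h = 2^k ε` the point `s - h` is `0`, so `f - f 0` at `2^k ε` is at most half its value
at twice the distance plus an error. After division by `2^k` that error is `P |ε|^θ 2^{(θ-1)k}`. -/
theorem sub_le_of_midpoint
    (hf : ∀ s h, f s ≤ (f (s + h) + f (s - h)) / 2 + P * |h| ^ θ) (ε : ℝ) (n : ℕ) :
    f ε - f 0 ≤ (f (2 ^ n * ε) - f 0) / 2 ^ n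
      + P * |ε| ^ θ * ∑ k ∈ Finset.range n, ((2 : ℝ) ^ (θ - 1)) ^ k := by
  induction n with
  | zero => simp
  | succ n ih =>
    have h := hf (2 ^ n * ε) (2 ^ n * ε)
    rw [sub_self, ← two_mul, ← mul_assoc, ← pow_succ', abs_mul, abs_of_pos (by positivity : (0:ℝ) < 2 ^ n),
      Real.mul_rpow (by positivity) (abs_nonneg _)] at h
    have hr : ((2 : ℝ) ^ (θ - 1)) ^ n = ((2 : ℝ) ^ n) ^ θ / 2 ^ n := by
      rw [Real.rpow_sub_one two_ne_zero, div_pow, ← Real.rpow_natCast, ← Real.rpow_mul two_pos.le,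
        ← Real.rpow_natCast 2 n, ← Real.rpow_mul two_pos.le, mul_comm]
    rw [Finset.sum_range_succ, hr]
    have h2 : (f (2 ^ n * ε) - f 0) / 2 ^ n
        ≤ (f (2 ^ (n + 1) * ε) - f 0) / 2 ^ (n + 1) + P * |ε| ^ θ * (((2 : ℝ) ^ n) ^ θ / 2 ^ n) := by
      rw [div_le_iff₀ (by positivity)]
      have e : ((f (2 ^ (n + 1) * ε) - f 0) / 2 ^ (n + 1)
          + P * |ε| ^ θ * (((2 : ℝ) ^ n) ^ θ / 2 ^ n)) * 2 ^ n
          = (f (2 ^ (n + 1) * ε) - f 0) / 2 + P * (((2 : ℝ) ^ n) ^ θ * |ε| ^ θ) := by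
        rw [pow_succ (2 : ℝ) n]; field_simp
      rw [e]
      linarith
    rw [mul_add]
    linarith

/-- The doubling stops at the largest `n` with `2^n |ε| ≤ 1`; then `2^{-n} < 2|ε|`, and the bounded
oscillation `Q` of `f` contributes at most `2Q|ε|`. -/
theorem abs_sub_le_of_midpoint
    (hf : ∀ s h, f s ≤ (f (s + h) + f (s - h)) / 2 + P * |h| ^ θ)
    (hQ : ∀ s t, f s ≤ f t + Q) {ε : ℝ} (hε : ε ≠ 0) (hε1 : |ε| ≤ 1 / 2) :
    ∃ n : ℕ, 1 ≤ n ∧ 2 ^ n ≤ 1 / |ε| ∧ |f ε - f 0| ≤ 2 * Q * |ε|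
      + P * |ε| ^ θ * ∑ k ∈ Finset.range n, ((2 : ℝ) ^ (θ - 1)) ^ k := by
  have hpos : 0 < |ε| := abs_pos.2 hε
  have h2 : 2 ≤ 1 / |ε| := by rw [le_div_iff₀ hpos]; linarith
  obtain ⟨n, hn1, hn2⟩ := exists_nat_pow_near (by linarith : 1 ≤ 1 / |ε|) one_lt_two
  have hQ0 : 0 ≤ Q := by linarith [hQ 0 0]
  have hn : 1 ≤ n := by
    rcases Nat.eq_zero_or_pos n with rfl | h
    · norm_num at hn2 h2; linarith
    · exact h
  have hinv : Q / 2 ^ n ≤ 2 * Q * |ε| := by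
    rw [div_le_iff₀ (by positivity)]
    rw [div_lt_iff₀ hpos, pow_succ] at hn2
    nlinarith
  have main : ∀ g : ℝ → ℝ, (∀ s h, g s ≤ (g (s + h) + g (s - h)) / 2 + P * |h| ^ θ) →
      (∀ s t, g s ≤ g t + Q) → g ε - g 0 ≤ 2 * Q * |ε|
        + P * |ε| ^ θ * ∑ k ∈ Finset.range n, ((2 : ℝ) ^ (θ - 1)) ^ k := by
    intro g hg hgQ
    refine (sub_le_of_midpoint hg ε n).trans (add_le_add_left ?_ _)
    refine le_trans ?_ hinv
    gcongr
    linarith [hgQ (2 ^ n * ε) 0]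
  refine ⟨n, hn, hn1, abs_le.2 ⟨?_, main f hf hQ⟩⟩
  -- The reflected function satisfies the same hypotheses and exchanges the roles of `f ε` and `f
  -- 0`, which gives the lower bound.
  have h := main (fun t => f (ε - t)) (fun s h => ?_) fun s t => hQ _ _
  · simp only [sub_self, sub_zero] at h
    linarith
  · have := hf (ε - s) h
    have e1 : ε - (s + h) = ε - s - h := by ring
    have e2 : ε - (s - h) = ε - s + h := by ring
    rw [e1, e2]
    linarith

theorem abs_sub_le_rpow_of_midpoint (hP : 0 ≤ P) (hθ : 0 < θ) (hθ1 : θ < 1)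
    (hf : ∀ s h, f s ≤ (f (s + h) + f (s - h)) / 2 + P * |h| ^ θ)
    (hQ : ∀ s t, f s ≤ f t + Q) {ε : ℝ} (hε1 : |ε| ≤ 1 / 2) :
    |f ε - f 0| ≤ (2 * Q + P / (1 - 2 ^ (θ - 1))) * |ε| ^ θ := by
  rcases eq_or_ne ε 0 with rfl | hε
  · simp [Real.zero_rpow hθ.ne']
  have hQ0 : 0 ≤ Q := by linarith [hQ 0 0]
  obtain ⟨n, -, -, h⟩ := abs_sub_le_of_midpoint hf hQ hε hε1
  have hr : (2 : ℝ) ^ (θ - 1) < 1 := Real.rpow_lt_one_of_one_lt_of_neg one_lt_two (by linarith)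
  have hr0 : (0 : ℝ) < 2 ^ (θ - 1) := by positivity
  have hs : ∑ k ∈ Finset.range n, ((2 : ℝ) ^ (θ - 1)) ^ k ≤ 1 / (1 - 2 ^ (θ - 1)) := by
    rw [geom_sum_eq hr.ne, ← neg_div_neg_eq, neg_sub, neg_sub]
    have := pow_pos hr0 n
    gcongr
    linarith
  have hle : |ε| ≤ |ε| ^ θ := by
    simpa using Real.rpow_le_rpow_of_exponent_ge (abs_pos.2 hε) (by linarith) hθ1.le
  have h1 : P * |ε| ^ θ * ∑ k ∈ Finset.range n, ((2 : ℝ) ^ (θ - 1)) ^ k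
      ≤ P * |ε| ^ θ * (1 / (1 - 2 ^ (θ - 1))) := by gcongr
  have h2 : 2 * Q * |ε| ≤ 2 * Q * |ε| ^ θ := by gcongr
  refine (h.trans (add_le_add h2 h1)).trans_eq ?_
  ring

/-- At the critical exponent every doubling costs the same `P |ε|`, and there are at most `log₂
(1/|ε|)` of them. Since `n ≥ 1`, this logarithm is at least `1` and absorbs the term `2Q|ε|` as
well. -/
theorem abs_sub_le_log_of_midpoint (hP : 0 ≤ P)
    (hf : ∀ s h, f s ≤ (f (s + h) + f (s - h)) / 2 + P * |h| ^ (1 : ℝ))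
    (hQ : ∀ s t, f s ≤ f t + Q) {ε : ℝ} (hε1 : |ε| ≤ 1 / 2) :
    |f ε - f 0| ≤ (2 * Q + P) / Real.log 2 * (|ε| * Real.log (1 / |ε|)) := by
  rcases eq_or_ne ε 0 with rfl | hε
  · simp
  have hQ0 : 0 ≤ Q := by linarith [hQ 0 0]
  obtain ⟨n, hn, hn2, h⟩ := abs_sub_le_of_midpoint hf hQ hε hε1
  simp only [sub_self, Real.rpow_zero, one_pow, Finset.sum_const, Finset.card_range, nsmul_eq_mul,
    mul_one, Real.rpow_one] at h
  have hlog : 0 < Real.log 2 := Real.log_pos one_lt_two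
  have hnl : n * Real.log 2 ≤ Real.log (1 / |ε|) := by
    rw [← Real.log_pow]
    exact Real.log_le_log (by positivity) hn2
  have hn1 : (1 : ℝ) ≤ n := by exact_mod_cast hn
  have hnle : (n : ℝ) ≤ Real.log (1 / |ε|) / Real.log 2 := by rwa [le_div_iff₀ hlog]
  have hε0 := abs_nonneg ε
  calc _ ≤ 2 * Q * |ε| + P * |ε| * n := h
    _ ≤ 2 * Q * |ε| * (Real.log (1 / |ε|) / Real.log 2)
        + P * |ε| * (Real.log (1 / |ε|) / Real.log 2) := by
      refine add_le_add (le_mul_of_one_le_right (by positivity) (hn1.trans hnle)) ?_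
      gcongr
    _ = _ := by ring

end MidpointConvexity

/-! ### The edge as a function of the field strength -/

section EdgeEstimates

variable {d : ℕ} {A : Space d → Space d} {K : Space d → Space d → ℂ} {c : ℂ} {M α : ℝ}

theorem edge_eq_upperEdge_twist_phase (hA : ContDiff ℝ 1 A) (s : ℝ) :
    edge A c K s = upperEdge (decayOp c (twist (phase fun x => s • A x) K)) := by
  rw [edge]
  congr 3
  ext x y
  exact (phase_smul hA s x y).symm

theorem edge_zero : edge A c K 0 = upperEdge (decayOp c K) := by
  rw [edge]
  simp only [zero_mul, twist_zero]

theorem slowEdge_eq_upperEdge_twist_phase (hA : ContDiff ℝ 1 A) (s : ℝ) :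
    slowEdge A c K s = upperEdge (decayOp c (twist (phase fun x => A (s • x)) K)) := by
  rw [slowEdge]
  congr 3
  ext x y
  exact (phase_comp_smul hA s x y).symm

theorem slowEdge_zero : slowEdge A c K 0 = upperEdge (decayOp c K) := by
  have h : slowPhase A 0 = fun _ _ => 0 := by
    ext x y; simp [slowPhase]
  rw [slowEdge, h, twist_zero]

/-- Phases are linear in the potential, so twisting the kernel already twisted by `sA` with `±hA`
reaches the field strengths `s ± h`, while the Schur norm is unchanged. -/
theorem edge_le_midpoint (hA : HasBoundedField M A) (hα : 0 < α) (hα2 : α ≤ 2)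
    (hK : IsSchurKernel α K) (hsa : IsSelfAdjoint (decayOp c K)) (s h : ℝ) :
    edge A c K s ≤ (edge A c K (s + h) + edge A c K (s - h)) / 2
      + (2 + (2 ^ (d + 2) + 3 * d ^ 4 * |M| ^ 2)) * (schurNorm α K).toReal * |h| ^ (α / 2) := by
  have hA1 := hA.contDiff
  rcases eq_or_ne h 0 with rfl | hh
  · simp [Real.zero_rpow (by positivity : α / 2 ≠ 0)]
  have hAs : ∀ r : ℝ, ContDiff ℝ 1 fun x => r • A x := fun r => hA1.const_smul r
  have hK0 := hK.mono hα.le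
  have hmid := upperEdge_le_midpoint (hAs h) hα.le hα2
    (hK.twist (continuous_phase (hAs s))) (isSelfAdjoint_twist_phase (hAs s) hK0 hsa)
    (abs_nonneg M) (abs_pos.2 hh) (fun p j k => by
      rw [magneticField_smul hA1, abs_mul, mul_comm]
      exact mul_le_mul_of_nonneg_right ((hA.bound p j k).trans (le_abs_self M)) (abs_nonneg _))
  have hadd : twist (phase fun x => h • A x) (twist (phase fun x => s • A x) K)
      = twist (phase fun x => (s + h) • A x) K := by
    rw [twist_twist]
    simp only [phase_smul hA1]
    congr 1
    ext x y
    rw [phase_smul hA1]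
    ring
  have hsub : twist (phase fun x => (-1 : ℝ) • h • A x) (twist (phase fun x => s • A x) K)
      = twist (phase fun x => (s - h) • A x) K := by
    rw [twist_twist]
    simp only [phase_smul (hAs h), phase_smul hA1]
    congr 1
    ext x y
    rw [phase_smul hA1]
    ring
  rw [hadd, hsub, schurNorm_twist] at hmid
  rw [edge_eq_upperEdge_twist_phase hA1, edge_eq_upperEdge_twist_phase hA1,
    edge_eq_upperEdge_twist_phase hA1]
  refine hmid.trans_eq ?_
  ring

theorem edge_le_edge_add (hA : ContDiff ℝ 1 A) (hα : 0 ≤ α) (hK : IsSchurKernel α K)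
    (hsa : IsSelfAdjoint (decayOp c K)) (s t : ℝ) :
    edge A c K s ≤ edge A c K t + 2 * (schurNorm α K).toReal := by
  have hAs : ∀ r : ℝ, ContDiff ℝ 1 fun x => r • A x := fun r => hA.const_smul r
  have hK0 := hK.mono hα
  rw [edge_eq_upperEdge_twist_phase hA, edge_eq_upperEdge_twist_phase hA]
  exact upperEdge_twist_le hα hK (continuous_phase (hAs s)) (continuous_phase (hAs t))
    (isSelfAdjoint_twist_phase (hAs s) hK0 hsa) (isSelfAdjoint_twist_phase (hAs t) hK0 hsa)

theorem tendsto_div_one_sub_two_rpow {C : ℝ} (hC : 0 < C) :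
    Tendsto (fun α : ℝ => 4 + C / (1 - 2 ^ (α / 2 - 1))) (𝓝[<] 2) atTop := by
  refine tendsto_atTop_add_const_left _ _ ?_
  have h : Tendsto (fun α : ℝ => 1 - (2 : ℝ) ^ (α / 2 - 1)) (𝓝[<] 2) (𝓝[>] 0) := by
    refine tendsto_nhdsWithin_iff.2 ⟨?_, ?_⟩
    · have hc : Continuous fun α : ℝ => 1 - (2 : ℝ) ^ (α / 2 - 1) :=
        continuous_const.sub (Continuous.rpow continuous_const (by fun_prop)
          fun _ => Or.inl two_ne_zero)
      have := (hc.tendsto 2).mono_left (nhdsWithin_le_nhds (s := Iio 2))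
      simpa using this
    · filter_upwards [self_mem_nhdsWithin] with α hα
      rw [mem_Iio] at hα
      have := Real.rpow_lt_one_of_one_lt_of_neg (x := 2) one_lt_two (by linarith : α / 2 - 1 < 0)
      rw [mem_Ioi]
      linarith
  simp only [div_eq_mul_inv]
  exact (tendsto_inv_nhdsGT_zero.comp h).const_mul_atTop hC

end EdgeEstimates

end MagneticEdge

end

/-! ### Assembly -/

theorem theorem1 (d : ℕ) (M : ℝ) :
    (∃ C : ℝ → ℝ, (∀ α ∈ Set.Ico (1 : ℝ) 2, 0 < C α) ∧ Tendsto C (𝓝[<] 2) atTop ∧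
      ∀ α ∈ Set.Ico (1 : ℝ) 2,
      ∀ A : MagneticEdge.Space d → MagneticEdge.Space d, MagneticEdge.HasBoundedField M A →
      ∀ (c : ℂ) (K : MagneticEdge.Space d → MagneticEdge.Space d → ℂ),
        MagneticEdge.IsSchurKernel α K → IsSelfAdjoint (MagneticEdge.decayOp c K) →
      ∀ ε : ℝ, |ε| ≤ 1 / 2 →
        |MagneticEdge.edge A c K ε - MagneticEdge.edge A c K 0|
          ≤ C α * (MagneticEdge.schurNorm α K).toReal * |ε| ^ (α / 2)) ∧
    (∃ C : ℝ, 0 < C ∧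
      ∀ α : ℝ, 2 ≤ α →
      ∀ A : MagneticEdge.Space d → MagneticEdge.Space d, MagneticEdge.HasBoundedField M A →
      ∀ (c : ℂ) (K : MagneticEdge.Space d → MagneticEdge.Space d → ℂ),
        MagneticEdge.IsSchurKernel α K → IsSelfAdjoint (MagneticEdge.decayOp c K) →
      ∀ ε : ℝ, |ε| ≤ 1 / 2 →
        |MagneticEdge.edge A c K ε - MagneticEdge.edge A c K 0|
          ≤ C * (MagneticEdge.schurNorm 2 K).toReal * (|ε| * Real.log (1 / |ε|))) ∧
    (∃ C : ℝ, 0 < C ∧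
      ∀ α : ℝ, 2 ≤ α →
      ∀ A : MagneticEdge.Space d → MagneticEdge.Space d, MagneticEdge.HasBoundedField M A →
      ∀ (c : ℂ) (K : MagneticEdge.Space d → MagneticEdge.Space d → ℂ),
        MagneticEdge.IsSchurKernel α K → IsSelfAdjoint (MagneticEdge.decayOp c K) →
      ∀ ε : ℝ, |ε| ≤ 1 / 2 →
        ((∀ x y, MagneticEdge.magneticField A x = MagneticEdge.magneticField A y) →
          |MagneticEdge.edge A c K ε - MagneticEdge.edge A c K 0|
            ≤ C * (MagneticEdge.schurNorm 2 K).toReal * |ε|) ∧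
        (MagneticEdge.HasBoundedFieldDeriv M A →
          |MagneticEdge.slowEdge A c K ε - MagneticEdge.slowEdge A c K 0|
            ≤ C * (MagneticEdge.schurNorm 2 K).toReal * |ε|)) := by
  have hC1 : 0 < 2 + ((2 : ℝ) ^ (d + 2) + 3 * d ^ 4 * |M| ^ 2) := by positivity
  -- The `4` is `2Q` with `Q` twice the Schur norm, and `1 - 2^(α/2-1)` comes from summing the
  -- geometric series; its vanishing at `α = 2` makes `C_α` blow up. In (iii) the value `Λ = d|M|`
  -- is dictated by the slowly varying case and is also valid for constant fields.
  refine ⟨⟨fun α => 4 + (2 + ((2 : ℝ) ^ (d + 2) + 3 * d ^ 4 * |M| ^ 2)) / (1 - 2 ^ (α / 2 - 1)),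
    fun α hα => ?_, MagneticEdge.tendsto_div_one_sub_two_rpow hC1,
    fun α hα A hA c K hK hsa ε hε => ?_⟩,
    ⟨(4 + (2 + ((2 : ℝ) ^ (d + 2) + 3 * d ^ 4 * |M| ^ 2))) / Real.log 2, ?_,
    fun α hα A hA c K hK hsa ε hε => ?_⟩,
    ⟨2 ^ (d + 2) + 3 * d ^ 2 * (d * |M|) + 3 * d ^ 4 * |M| ^ 2, by positivity,
    fun α hα A hA c K hK hsa ε hε => ⟨fun hconst => ?_, fun hA' => ?_⟩⟩⟩
  · have := Real.rpow_lt_one_of_one_lt_of_neg (x := 2) one_lt_two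
      (by linarith [hα.2] : α / 2 - 1 < 0)
    have h : 0 < 1 - (2 : ℝ) ^ (α / 2 - 1) := by linarith
    positivity
  · have hα0 : 0 < α := by linarith [hα.1]
    refine (MagneticEdge.abs_sub_le_rpow_of_midpoint (by positivity) (by linarith)
      (by linarith [hα.2]) (MagneticEdge.edge_le_midpoint hA hα0 hα.2.le hK hsa)
      (MagneticEdge.edge_le_edge_add hA.contDiff hα0.le hK hsa) hε).trans_eq ?_
    ring
  · have := Real.log_pos one_lt_two
    positivity
  · have hK2 := hK.mono hα
    have hmid := MagneticEdge.edge_le_midpoint hA two_pos le_rfl hK2 hsa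
    rw [div_self two_ne_zero] at hmid
    refine (MagneticEdge.abs_sub_le_log_of_midpoint (by positivity) hmid
      (MagneticEdge.edge_le_edge_add hA.contDiff zero_le_two hK2 hsa) hε).trans_eq ?_
    ring
  · rcases eq_or_ne ε 0 with rfl | hε0
    · simp
    rw [MagneticEdge.edge_zero, MagneticEdge.edge_eq_upperEdge_twist_phase hA.contDiff]
    refine MagneticEdge.abs_upperEdge_twist_phase_sub_le (hA.contDiff.const_smul ε) hα hK hsa
      (abs_nonneg M) (abs_pos.2 hε0) (fun p j k => ?_) (by positivity) (fun p q j k => ?_)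
    · rw [MagneticEdge.magneticField_smul hA.contDiff, abs_mul, mul_comm]
      exact mul_le_mul_of_nonneg_right ((hA.bound p j k).trans (le_abs_self M)) (abs_nonneg _)
    · rw [MagneticEdge.magneticField_smul hA.contDiff, MagneticEdge.magneticField_smul hA.contDiff,
        hconst p q, sub_self, abs_zero]
      positivity
  · rcases eq_or_ne ε 0 with rfl | hε0
    · simp
    rw [MagneticEdge.slowEdge_zero, MagneticEdge.slowEdge_eq_upperEdge_twist_phase hA.contDiff]
    refine MagneticEdge.abs_upperEdge_twist_phase_sub_le (A := fun x => A (ε • x))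
      (hA.contDiff.comp (contDiff_id.const_smul ε)) hα hK hsa
      (abs_nonneg M) (abs_pos.2 hε0) (fun p j k => ?_) (by positivity) (fun p q j k => ?_)
    · rw [MagneticEdge.magneticField_comp_smul hA.contDiff, abs_mul, mul_comm]
      exact mul_le_mul_of_nonneg_right ((hA.bound _ j k).trans (le_abs_self M)) (abs_nonneg _)
    -- The field of `x ↦ A(εx)` is `ε B(εx)`: one factor of `ε` comes from its size and a second
    -- from its variation, which is the `h²` required of the Lipschitz constant.
    · rw [MagneticEdge.magneticField_comp_smul hA.contDiff,
        MagneticEdge.magneticField_comp_smul hA.contDiff, ← mul_sub, abs_mul]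
      refine (mul_le_mul_of_nonneg_left (hA'.abs_sub_le _ _ j k) (abs_nonneg ε)).trans_eq ?_
      rw [← smul_sub, norm_smul, Real.norm_eq_abs]
      ring
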